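/- Let $X,Y$ be Polish spaces with Borel probability measures $\mu,\nu$, let $\Pi(\mu,\nu)$ be the set of Borel probability measures on $X\times Y$ with marginals $\mu$ and $\nu$, let $c:X\times Y\to[0,\infty]$ be Borel measurable, and let $\pi_0\in\Pi(\mu,\nu)$ satisfy $\int c\,d\pi_0<\infty$. Write $(\phi\oplus\psi)(x,y)=\phi(x)+\psi(y)$. Let $\Pi^{(\pi_0)}(\mu,\nu)$ be the set of $\pi\in\Pi(\mu,\nu)$ with $\pi\ll\pi_0$ and $\frac{d\pi}{d\pi_0}\in L^\infty(\pi_0)$, and put $$P^{(\pi_0)}=\inf\Big\{\int c\,d\pi:\ \pi\in\Pi^{(\pi_0)}(\mu,\nu)\Big\},\qquad D^{(\pi_0)}=\lim_{\varepsilon\downarrow0}D^{(\pi_0,\varepsilon)},$$ $$D^{(\pi_0,\varepsilon)}=\sup\Big\{\int\phi\,d\mu+\int\psi\,d\nu:\ \phi\in L^1(\mu),\ \psi\in L^1(\nu),\ \int(\phi\oplus\psi-c)_+\,d\pi_0\le\varepsilon\Big\}.$$ Let $L^1_S(\pi_0)$ be the closed linear subspace of $L^1(\pi_0)$ spanned by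 the functions $\phi\oplus\psi$ with $\phi\in L^1(\mu)$, $\psi\in L^1(\nu)$; its bidual is regarded as a subspace of $L^1(\pi_0)^{**}=L^\infty(\pi_0)^*$, and a plan $\pi\in\Pi^{(\pi_0)}(\mu,\nu)$ is identified with $\frac{d\pi}{d\pi_0}\in L^\infty(\pi_0)$. An element $s\in L^\infty(\pi_0)^*$ is said to vanish on a set $B$ if $\langle s,\gamma\rangle=0$ for every $\gamma\in L^\infty(\pi_0)$ that is zero $\pi_0$-a.e. outside $B$. It is purely singular if there are measurable sets $A_1\supseteq A_2\supseteq\cdots$ with $\pi_0(A_k)\to0$ such that $s$ vanishes on the complement of every $A_k$. Each $h\in L^\infty(\pi_0)^*$ decomposes uniquely as $h=h^r+h^s$ with $h^r\in L^1(\pi_0)$ and $h^s$ purely singular. Then the limit defining $D^{(\pi_0)}$ exists and $P^{(\pi_0)}=D^{(\pi_0)}$. Moreover, there is $\hat h\in L^1_S(\pi_0)^{**}$ with the following properties. 1. $\hat h\le c$ in the Banach lattice $L^1(\pi_0)^{**}$ (so that $\hat h^r\le c$ $\pi_0$-a.s. and $\hat h^s\le0$), and $D^{(\pi_0)}=\langle\hat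 h,\pi_0\rangle$. 2. If $\pi\in\Pi^{(\pi_0)}(\mu,\nu)$ and $\alpha\ge0$ satisfy $\int c\,d\pi\le P^{(\pi_0)}+\alpha$, then $-\alpha\le\langle\hat h^s,\pi\rangle\le0$. In particular, if $\pi\in\Pi^{(\pi_0)}(\mu,\nu)$ satisfies $\int c\,d\pi=P^{(\pi_0)}$, then $\hat h^s$ vanishes on the set $\{\frac{d\pi}{d\pi_0}>\varepsilon\}$ for every $\varepsilon>0$. 3. There are $(\phi_n,\psi_n)\in L^1(\mu)\times L^1(\nu)$, $n\in\mathbb N$, such that $\phi_n\oplus\psi_n\to\hat h^r$ $\pi_0$-a.s., $\|(\phi_n\oplus\psi_n-\hat h^r)_+\|_{L^1(\pi_0)}\to0$, and $$\lim_{\delta\downarrow0}\ \sup_{A:\ \pi_0(A)<\delta}\ \lim_{n\to\infty}\Big(-\int_A\phi_n\oplus\psi_n\,d\pi_0\Big)=\|\hat h^s\|_{L^1(\pi_0)^{**}},$$ where $A$ ranges over the measurable sets for which the inner limit exists; the same equality holds when $A$ ranges over all measurable sets and the inner limit is replaced by the limit inferior, and also when it is replaced by the limit superior. -/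

import Mathlib

open MeasureTheory Filter Topology Set
open scoped ENNReal NNReal

noncomputable section

namespace MongeKantorovich

variable {X Y : Type*} [MeasurableSpace X] [MeasurableSpace Y]

/-- The transport plans between `μ` and `ν`: probability measures on `X × Y` with these marginals. -/
def transportPlans (μ : Measure X) (ν : Measure Y) : Set (Measure (X × Y)) :=
  {π | IsProbabilityMeasure π ∧ π.fst = μ ∧ π.snd = ν}

/-- The transport plans of finite cost. -/
def finitePlans (μ : Measure X) (ν : Measure Y) (c : X × Y → ℝ≥0∞) : Set (Measure (X × Y)) :=
  {π | π ∈ transportPlans μ ν ∧ ∫⁻ z, c z ∂π < ∞}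

/-- The transport plans that are absolutely continuous with respect to `π₀` and whose
Radon-Nikodym derivative is essentially bounded. -/
def boundedPlans (μ : Measure X) (ν : Measure Y) (π₀ : Measure (X × Y)) :
    Set (Measure (X × Y)) :=
  {π | π ∈ transportPlans μ ν ∧ π ≪ π₀ ∧ essSup (π.rnDeriv π₀) π₀ < ∞}

/-- The primal value `P^(π₀)`. -/
def primalValue (μ : Measure X) (ν : Measure Y) (c : X × Y → ℝ≥0∞) (π₀ : Measure (X × Y)) :
    ℝ≥0∞ :=
  ⨅ π ∈ boundedPlans μ ν π₀, ∫⁻ z, c z ∂π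

/-- The function `φ ⊕ ψ`. -/
def oplus (φ : X → ℝ) (ψ : Y → ℝ) (z : X × Y) : ℝ := φ z.1 + ψ z.2

/-- The values `∫ φ dμ + ∫ ψ dν` of the pairs that violate `φ ⊕ ψ ≤ c` by at most `ε` in `L¹(π₀)`.
As `c ≥ 0`, the truncated subtraction of `ℝ≥0∞` makes the integrand `(φ ⊕ ψ - c)₊`, which is `0`
where `c = ∞`. -/
def relaxedDualValues (μ : Measure X) (ν : Measure Y) (c : X × Y → ℝ≥0∞) (π₀ : Measure (X × Y))
    (ε : ℝ) : Set EReal :=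
  {d | ∃ (φ : X → ℝ) (ψ : Y → ℝ), Integrable φ μ ∧ Integrable ψ ν ∧
    ∫⁻ z, (ENNReal.ofReal (oplus φ ψ z) - c z) ∂π₀ ≤ ENNReal.ofReal ε ∧
    d = ((∫ x, φ x ∂μ + ∫ y, ψ y ∂ν : ℝ) : EReal)}

/-- The relaxed dual value `D^(π₀, ε)`. -/
def relaxedDualValue (μ : Measure X) (ν : Measure Y) (c : X × Y → ℝ≥0∞) (π₀ : Measure (X × Y))
    (ε : ℝ) : EReal :=
  sSup (relaxedDualValues μ ν c π₀ ε)

/-- The dual value `D^(π₀)`, the limit of `D^(π₀, ε)` as `ε ↓ 0`. -/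
def dualValue (μ : Measure X) (ν : Measure Y) (c : X × Y → ℝ≥0∞) (π₀ : Measure (X × Y)) : EReal :=
  limUnder (𝓝[>] (0 : ℝ)) (relaxedDualValue μ ν c π₀)

/-- The closed linear subspace `L¹_S(π₀)` of `L¹(π₀)` spanned by the (classes of the) functions
`φ ⊕ ψ` with `φ ∈ L¹(μ)` and `ψ ∈ L¹(ν)`. -/
def L1S (μ : Measure X) (ν : Measure Y) (π₀ : Measure (X × Y)) : Submodule ℝ (Lp ℝ 1 π₀) :=
  (Submodule.span ℝ {f : Lp ℝ 1 π₀ | ∃ (φ : X → ℝ) (ψ : Y → ℝ),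
    Integrable φ μ ∧ Integrable ψ ν ∧ f =ᵐ[π₀] oplus φ ψ}).topologicalClosure

section Bidual

variable {Z : Type*} [MeasurableSpace Z]

/-- The canonical embedding of `L¹` into `(L^∞)^* = (L¹)^{**}`, `f ↦ (γ ↦ ∫ f γ dm)`. -/
def regular (m : Measure Z) : Lp ℝ 1 m →L[ℝ] StrongDual ℝ (Lp ℝ ∞ m) :=
  (ContinuousLinearMap.mul ℝ ℝ).lpPairing m 1 ∞

/-- The identification of `γ ∈ L^∞` with the functional `f ↦ ∫ f γ dm` in `(L¹)^*`. -/
def linftyToDual (m : Measure Z) : Lp ℝ ∞ m →L[ℝ] StrongDual ℝ (Lp ℝ 1 m) :=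
  (regular m).flip

/-- The embedding of the bidual of a subspace `E` of `L¹` into `(L^∞)^* = (L¹)^{**}`: the adjoint of
the map that sends `γ ∈ L^∞ = (L¹)^*` to its restriction to `E`. -/
def bidualEmb (m : Measure Z) (E : Submodule ℝ (Lp ℝ 1 m)) (h : StrongDual ℝ (StrongDual ℝ E)) :
    StrongDual ℝ (Lp ℝ ∞ m) :=
  h ∘L (ContinuousLinearMap.precomp ℝ E.subtypeL) ∘L linftyToDual m

/-- The lattice order of `(L^∞)^* = (L¹)^{**}`. -/
def DualLE {m : Measure Z} (g₁ g₂ : StrongDual ℝ (Lp ℝ ∞ m)) : Prop :=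
  ∀ γ : Lp ℝ ∞ m, 0 ≤ γ → g₁ γ ≤ g₂ γ

/-- `s` vanishes on the set `A`: it is zero on all elements of `L^∞` that are zero a.e. outside
`A`. -/
def VanishesOn {m : Measure Z} (s : StrongDual ℝ (Lp ℝ ∞ m)) (A : Set Z) : Prop :=
  ∀ γ : Lp ℝ ∞ m, (∀ᵐ z ∂m, z ∉ A → γ z = 0) → s γ = 0

/-- Purely singular elements of `(L^∞)^*`: those carried by each set of some decreasing sequence of
measurable sets whose measures tend to zero. -/
def PurelySingular {m : Measure Z} (s : StrongDual ℝ (Lp ℝ ∞ m)) : Prop :=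
  ∃ A : ℕ → Set Z, (∀ k, MeasurableSet (A k)) ∧ Antitone A ∧
    Tendsto (fun k => m (A k)) atTop (𝓝 0) ∧ ∀ k, VanishesOn s (A k)ᶜ

/-- `g` has regular part `r` and purely singular part `s`. -/
def IsDecomposition {m : Measure Z} (g : StrongDual ℝ (Lp ℝ ∞ m)) (r : Lp ℝ 1 m)
    (s : StrongDual ℝ (Lp ℝ ∞ m)) : Prop :=
  g = regular m r + s ∧ PurelySingular s

/-- The limit inferior of the masses that `-f n` puts on `A`, optimized over the sets `A` of measure
less than `δ`. -/
def escapeInf (m : Measure Z) (f : ℕ → Z → ℝ) (δ : ℝ≥0∞) : EReal :=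
  ⨆ (A : Set Z) (_ : MeasurableSet A) (_ : m A < δ),
    liminf (fun n => ((-∫ z in A, f n z ∂m : ℝ) : EReal)) atTop

/-- The same with the limit superior. -/
def escapeSup (m : Measure Z) (f : ℕ → Z → ℝ) (δ : ℝ≥0∞) : EReal :=
  ⨆ (A : Set Z) (_ : MeasurableSet A) (_ : m A < δ),
    limsup (fun n => ((-∫ z in A, f n z ∂m : ℝ) : EReal)) atTop

/-- The same with the limit, over those `A` for which this limit exists. -/
def escapeLim (m : Measure Z) (f : ℕ → Z → ℝ) (δ : ℝ≥0∞) : EReal :=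
  ⨆ (A : Set Z) (_ : MeasurableSet A) (_ : m A < δ) (l : ℝ)
    (_ : Tendsto (fun n => -∫ z in A, f n z ∂m) atTop (𝓝 l)), (l : EReal)

end Bidual

theorem memLp_density {μ : Measure X} {ν : Measure Y} {π₀ π : Measure (X × Y)}
    (hπ : π ∈ boundedPlans μ ν π₀) : MemLp (fun z => (π.rnDeriv π₀ z).toReal) ∞ π₀ := by
  refine memLp_top_of_bound (Measure.measurable_rnDeriv π π₀).ennreal_toReal.aestronglyMeasurable
    (essSup (π.rnDeriv π₀) π₀).toReal ?_
  filter_upwards [ENNReal.ae_le_essSup (μ := π₀) (π.rnDeriv π₀)] with z hz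
  rw [Real.norm_of_nonneg ENNReal.toReal_nonneg]
  exact ENNReal.toReal_mono hπ.2.2.ne hz

/-- The class of `dπ/dπ₀` in `L^∞(π₀)`. -/
def density {μ : Measure X} {ν : Measure Y} {π₀ π : Measure (X × Y)}
    (hπ : π ∈ boundedPlans μ ν π₀) : Lp ℝ ∞ π₀ :=
  (memLp_density hπ).toLp _

theorem memLp_cost {μ : Measure X} {ν : Measure Y} {c : X × Y → ℝ≥0∞} {π₀ : Measure (X × Y)}
    (hc : Measurable c) (hπ₀ : π₀ ∈ finitePlans μ ν c) :
    MemLp (fun z => (c z).toReal) 1 π₀ :=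
  memLp_one_iff_integrable.2 (integrable_toReal_of_lintegral_ne_top hc.aemeasurable hπ₀.2.ne)

/-- The class of the (`π₀`-a.e. finite) function `c` in `L¹(π₀)`. -/
def costClass {μ : Measure X} {ν : Measure Y} {c : X × Y → ℝ≥0∞} {π₀ : Measure (X × Y)}
    (hc : Measurable c) (hπ₀ : π₀ ∈ finitePlans μ ν c) : Lp ℝ 1 π₀ :=
  (memLp_cost hc hπ₀).toLp _

theorem mem_boundedPlans_self {μ : Measure X} {ν : Measure Y} {c : X × Y → ℝ≥0∞}
    {π₀ : Measure (X × Y)} (hπ₀ : π₀ ∈ finitePlans μ ν c) : π₀ ∈ boundedPlans μ ν π₀ := by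
  have := hπ₀.1.1
  refine ⟨hπ₀.1, Measure.AbsolutelyContinuous.refl _, ?_⟩
  refine lt_of_le_of_lt (essSup_le_of_ae_le 1 ?_) ENNReal.one_lt_top
  filter_upwards [Measure.rnDeriv_self π₀] with z hz
  simp [hz]

end MongeKantorovich

end

open MongeKantorovich

noncomputable section

namespace MongeKantorovich

/-! ### Positive functionals on `L^∞` and the duality of `L¹` with `L^∞`. -/

section Functionals

variable {Z : Type*} [MeasurableSpace Z] {m : Measure Z}

/-! Let `N ⊆ L^∞(π₀)` be the annihilator of all `φ ⊕ ψ`. The `γ ≥ 0` with `γ - 1 ∈ N` are exactly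
the densities of bounded plans (`density_sub_mem`, `withDensity_mem_boundedPlans`), so `P` is the
value of a linear programme in `L^∞`. As `1` is an order unit there, the dual problem is attained:
on `N + ℝ1` the functional `γ + t ↦ ⟨c, γ⟩ + t(⟨c, 1⟩ - P)` is positive by the definition of `P`,
and M. Riesz extends it to a positive `G`. Then `H = c - G` lies below `c`, kills `N` and has `H(1)
= P` (`exists_dual_functional`). Killing `N` is what puts `H` into the bidual of `L¹_S`
(`exists_bidualEmb_eq`).

The Yosida-Hewitt decomposition `G = r + s` with `r, s ≥ 0` (`exists_isDecomposition_of_nonneg`)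
gives `H` the regular part `c - r` and the singular part `-s`. Every bounded plan has `H(π) = P`,
hence `∫ c dπ - P = ⟨r, π⟩ + s(π)` is a sum of two nonnegative terms, and this is complementary
slackness.

For a set `A` that carries `s`, Hahn-Banach brings functions `φ ⊕ ψ` arbitrarily close in `L¹` to
functions `c - r - u`, where `u ≥ 0` is carried by `A` and has integral `s(1) = ‖s‖`
(`exists_approx`). With errors at most `2⁻ⁿ` and `π₀(Aₙ) ≤ 2⁻ⁿ`, Borel-Cantelli gives almost sure
convergence to `c - r`, while the mass `‖s‖` escapes on the sets `Aₙ`. The integrals of these `φₙ ⊕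
ψₙ` tend to `H(1) = P` and their excess over `c` vanishes, so `D ≥ P`; weak duality gives `D ≤ P`.
-/

theorem regular_apply (f : Lp ℝ 1 m) (γ : Lp ℝ ∞ m) : regular m f γ = ∫ z, f z * γ z ∂m := by
  simp [regular, ContinuousLinearMap.lpPairing_eq_integral]

theorem linftyToDual_apply (γ : Lp ℝ ∞ m) (f : Lp ℝ 1 m) :
    linftyToDual m γ f = ∫ z, f z * γ z ∂m :=
  regular_apply f γ

theorem integrable_mul_linfty {f : Z → ℝ} (hf : Integrable f m) (γ : Lp ℝ ∞ m) :
    Integrable (fun z => f z * γ z) m :=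
  memLp_one_iff_integrable.1 ((Lp.memLp γ).mul (memLp_one_iff_integrable.2 hf))

theorem ae_norm_le_norm (γ : Lp ℝ ∞ m) : ∀ᵐ z ∂m, |γ z| ≤ ‖γ‖ := by
  filter_upwards [ae_le_eLpNormEssSup (f := γ) (μ := m)] with z hz
  rw [← eLpNorm_exponent_top] at hz
  have := ENNReal.toReal_mono (Lp.eLpNorm_ne_top γ) hz
  simpa [Lp.norm_def] using this

/-- Every continuous linear functional on `L¹` of a probability measure is given by an element of
`L^∞` whose norm is at most that of the functional. -/
theorem exists_linftyToDual_eq [IsProbabilityMeasure m] (ℓ : StrongDual ℝ (Lp ℝ 1 m)) :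
    ∃ γ : Lp ℝ ∞ m, linftyToDual m γ = ℓ ∧ ‖γ‖ ≤ ‖ℓ‖ := by
  have h12 : (1 : ℝ≥0∞) ≤ 2 := by norm_num
  have hmem (f : Lp ℝ 2 m) : MemLp f 1 m := (Lp.memLp f).mono_exponent h12
  -- On a probability space `L²` embeds contractively into `L¹`, so the functional restricts to
  -- `L²`, where the Riesz representation supplies `γ`.
  let ℓ₂ : Lp ℝ 2 m →ₗ[ℝ] ℝ :=
    { toFun := fun f => ℓ ((hmem f).toLp f)
      map_add' := fun f g => by
        rw [← map_add, ← MemLp.toLp_add]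
        congr 1
        exact MemLp.toLp_congr _ _ (Lp.coeFn_add f g)
      map_smul' := fun a f => by
        rw [RingHom.id_apply, ← map_smul, ← MemLp.toLp_const_smul]
        congr 1
        exact MemLp.toLp_congr _ _ (Lp.coeFn_smul a f) }
  have hbound (f : Lp ℝ 2 m) : ‖ℓ₂ f‖ ≤ ‖ℓ‖ * ‖f‖ := by
    refine (ℓ.le_opNorm _).trans (mul_le_mul_of_nonneg_left ?_ (norm_nonneg _))
    rw [Lp.norm_toLp, Lp.norm_def]
    exact ENNReal.toReal_mono (Lp.eLpNorm_ne_top f)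
      (eLpNorm_le_eLpNorm_of_exponent_le h12 (Lp.aestronglyMeasurable f))
  set γ := (InnerProductSpace.toDual ℝ (Lp ℝ 2 m)).symm (ℓ₂.mkContinuous _ hbound) with hγ
  have hrep (f : Lp ℝ 2 m) : ∫ z, f z * γ z ∂m = ℓ ((hmem f).toLp f) := by
    have := InnerProductSpace.toDual_symm_apply (𝕜 := ℝ) (x := f) (y := ℓ₂.mkContinuous _ hbound)
    rw [← hγ, L2.inner_def] at this
    simpa [ℓ₂] using this
  have hind {A : Set Z} (hA : MeasurableSet A) :
      ∫ z in A, γ z ∂m = ℓ (indicatorConstLp 1 hA (measure_ne_top m A) 1) := by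
    have h2 := hrep (indicatorConstLp 2 hA (measure_ne_top m A) 1)
    have : (hmem (indicatorConstLp 2 hA (measure_ne_top m A) 1)).toLp _ =
        indicatorConstLp 1 hA (measure_ne_top m A) (1 : ℝ) :=
      MemLp.toLp_congr _ _ indicatorConstLp_coeFn
    rw [this] at h2
    rw [← h2, ← integral_indicator hA]
    refine integral_congr_ae ?_
    filter_upwards [indicatorConstLp_coeFn (p := 2) (hs := hA) (hμs := measure_ne_top m A)
      (c := (1 : ℝ))] with z hz
    rw [hz]
    by_cases h : z ∈ A <;> simp [h]
  have hInt : Integrable γ m := (Lp.memLp γ).integrable h12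
  -- Averages of `γ` over all sets are bounded by `‖ℓ‖`, hence so is `γ` itself almost everywhere.
  have habs {A : Set Z} (hA : MeasurableSet A) : |∫ z in A, γ z ∂m| ≤ ‖ℓ‖ * m.real A := by
    rw [hind hA]
    refine (ℓ.le_opNorm _).trans (mul_le_mul_of_nonneg_left ?_ (norm_nonneg _))
    rw [norm_indicatorConstLp one_ne_zero ENNReal.one_ne_top]
    simp
  have hup : ∀ᵐ z ∂m, γ z ≤ ‖ℓ‖ := by
    refine ae_le_of_forall_setIntegral_le hInt (integrable_const _) fun A hA _ => ?_
    simpa [mul_comm] using (le_abs_self _).trans (habs hA)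
  have hlow : ∀ᵐ z ∂m, -‖ℓ‖ ≤ γ z := by
    refine ae_le_of_forall_setIntegral_le (integrable_const _) hInt fun A hA _ => ?_
    simpa [mul_comm] using (abs_le.1 (habs hA)).1
  have hle : ∀ᵐ z ∂m, ‖γ z‖ ≤ ‖ℓ‖ := by
    filter_upwards [hup, hlow] with z h1 h2 using abs_le.2 ⟨h2, h1⟩
  have hγtop : MemLp γ ∞ m := memLp_top_of_bound (Lp.aestronglyMeasurable γ) ‖ℓ‖ hle
  refine ⟨hγtop.toLp γ, ?_, ?_⟩
  swap
  · have hae : ∀ᵐ z ∂m, ‖hγtop.toLp γ z‖ ≤ ‖ℓ‖ := by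
      filter_upwards [hle, hγtop.coeFn_toLp] with z h1 h2
      rwa [h2]
    simpa using Lp.norm_le_of_ae_bound (norm_nonneg ℓ) hae
  ext f
  induction f using Lp.induction (ENNReal.one_ne_top) with
  | @indicatorConst a s hs hms =>
    rw [Lp.simpleFunc.coe_indicatorConst, linftyToDual_apply]
    have : indicatorConstLp 1 hs hms.ne a = a • indicatorConstLp 1 hs hms.ne (1 : ℝ) := by
      rw [indicatorConstLp, indicatorConstLp, ← MemLp.toLp_const_smul]
      refine MemLp.toLp_congr _ _ (ae_of_all _ fun z => ?_)
      by_cases h : z ∈ s <;> simp [h]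
    rw [this, map_smul, ← hind hs, ← integral_indicator hs, smul_eq_mul, ← integral_const_mul,
      ← this]
    refine integral_congr_ae ?_
    filter_upwards [indicatorConstLp_coeFn (p := 1) (hs := hs) (hμs := hms.ne) (c := a),
      hγtop.coeFn_toLp] with z h1 h2
    rw [h1, h2]
    by_cases h : z ∈ s <;> simp [h]
  | @add f g hf hg hd h1 h2 => rw [map_add, map_add, h1, h2]
  | isClosed => exact isClosed_eq (linftyToDual m _).continuous ℓ.continuous

theorem monotone_of_nonneg {g : Lp ℝ ∞ m →ₗ[ℝ] ℝ} (hg : ∀ γ, 0 ≤ γ → 0 ≤ g γ) : Monotone g := by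
  intro γ₁ γ₂ h
  simpa using hg _ (sub_nonneg.2 h)

/-- If a positive functional vanishes at `w`, it vanishes at everything dominated by `w`. -/
theorem eq_zero_of_abs_le {g : StrongDual ℝ (Lp ℝ ∞ m)} (hg : ∀ γ, 0 ≤ γ → 0 ≤ g γ)
    {w γ : Lp ℝ ∞ m} (hw : g w = 0) {a : ℝ} (h : ∀ᵐ z ∂m, |γ z| ≤ a * w z) : g γ = 0 := by
  have h1 : g γ ≤ g (a • w) := by
    refine monotone_of_nonneg (g := g.toLinearMap) hg ?_
    rw [← Lp.coeFn_le]
    filter_upwards [h, Lp.coeFn_smul a w] with z h1 h2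
    rw [h2]
    exact (le_abs_self _).trans h1
  have h2 : g (-γ) ≤ g (a • w) := by
    refine monotone_of_nonneg (g := g.toLinearMap) hg ?_
    rw [← Lp.coeFn_le]
    filter_upwards [h, Lp.coeFn_smul a w, Lp.coeFn_neg γ] with z h1 h2 h3
    rw [h2, h3]
    exact (neg_le_abs _).trans h1
  rw [map_smul, hw, smul_zero] at h1 h2
  rw [map_neg] at h2
  linarith

section Positive

variable [IsProbabilityMeasure m]

/-- The constant function `1` in `L^∞`. -/
def linftyOne (m : Measure Z) [IsProbabilityMeasure m] : Lp ℝ ∞ m := Lp.const ∞ m 1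

/-- The indicator function of a measurable set in `L^∞`. -/
def linftyInd (m : Measure Z) [IsProbabilityMeasure m] {A : Set Z} (hA : MeasurableSet A) :
    Lp ℝ ∞ m :=
  indicatorConstLp ∞ hA (measure_ne_top m A) 1

theorem coeFn_linftyOne : ∀ᵐ z ∂m, linftyOne m z = 1 := Lp.coeFn_const ..

theorem coeFn_linftyInd {A : Set Z} (hA : MeasurableSet A) :
    linftyInd m hA =ᵐ[m] A.indicator fun _ => 1 :=
  indicatorConstLp_coeFn

theorem linftyInd_univ : linftyInd m MeasurableSet.univ = linftyOne m := by
  rw [linftyInd, linftyOne, indicatorConstLp_univ]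

theorem linftyInd_nonneg {A : Set Z} (hA : MeasurableSet A) : 0 ≤ linftyInd m hA := by
  rw [← Lp.coeFn_nonneg]
  filter_upwards [coeFn_linftyInd (m := m) hA] with z hz
  rw [hz]
  exact indicator_nonneg (fun _ _ => zero_le_one) z

theorem norm_linftyOne_le : ‖linftyOne m‖ ≤ 1 := by
  simpa [linftyOne] using Lp.norm_const_le (p := ∞) (μ := m) (c := (1 : ℝ))

theorem le_norm_smul_linftyOne (γ : Lp ℝ ∞ m) : γ ≤ ‖γ‖ • linftyOne m := by
  rw [← Lp.coeFn_le]
  filter_upwards [ae_norm_le_norm γ, Lp.coeFn_smul ‖γ‖ (linftyOne m), coeFn_linftyOne (m := m)]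
    with z h1 h2 h3
  simpa [h2, h3] using (le_abs_self _).trans h1

/-- Since `-‖γ‖ ≤ γ ≤ ‖γ‖`, positivity alone forces continuity. This makes the extension in
`exists_dual_functional` continuous, and it identifies the norm of a positive functional with its
value at `1`. -/
theorem abs_le_norm_mul_of_nonneg {g : Lp ℝ ∞ m →ₗ[ℝ] ℝ} (hg : ∀ γ, 0 ≤ γ → 0 ≤ g γ)
    (γ : Lp ℝ ∞ m) : |g γ| ≤ ‖γ‖ * g (linftyOne m) := by
  have h1 := monotone_of_nonneg hg (le_norm_smul_linftyOne γ)
  have h2 := monotone_of_nonneg hg (le_norm_smul_linftyOne (-γ))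
  rw [map_smul, smul_eq_mul] at h1
  rw [map_smul, smul_eq_mul, norm_neg, map_neg] at h2
  exact abs_le.2 ⟨by linarith, h1⟩

theorem norm_eq_of_nonneg {g : StrongDual ℝ (Lp ℝ ∞ m)} (hg : ∀ γ, 0 ≤ γ → 0 ≤ g γ) :
    ‖g‖ = g (linftyOne m) := by
  have h0 : 0 ≤ g (linftyOne m) := by
    rw [← linftyInd_univ]
    exact hg _ (linftyInd_nonneg _)
  refine le_antisymm (g.opNorm_le_bound h0 fun γ => ?_) ?_
  · rw [mul_comm]
    exact abs_le_norm_mul_of_nonneg (g := g.toLinearMap) hg γ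
  · calc g (linftyOne m) ≤ ‖g (linftyOne m)‖ := le_abs_self _
      _ ≤ ‖g‖ * ‖linftyOne m‖ := g.le_opNorm _
      _ ≤ ‖g‖ := mul_le_of_le_one_right (norm_nonneg _) norm_linftyOne_le

end Positive

end Functionals

/-! ### The Yosida-Hewitt decomposition of a positive functional. -/

section YosidaHewitt

variable {Z : Type*} [MeasurableSpace Z] {m : Measure Z} [IsProbabilityMeasure m]

theorem regular_linftyInd (r : Lp ℝ 1 m) {A : Set Z} (hA : MeasurableSet A) :
    regular m r (linftyInd m hA) = ∫ z in A, r z ∂m := by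
  rw [regular_apply, ← integral_indicator hA]
  refine integral_congr_ae ?_
  filter_upwards [coeFn_linftyInd (m := m) hA] with z hz
  rw [hz]
  by_cases h : z ∈ A <;> simp [h]

theorem linftyInd_inter_add_diff {A B : Set Z} (hA : MeasurableSet A) (hB : MeasurableSet B) :
    linftyInd m (hA.inter hB) + linftyInd m (hA.diff hB) = linftyInd m hA := by
  refine Lp.ext ?_
  filter_upwards [Lp.coeFn_add (linftyInd m (hA.inter hB)) (linftyInd m (hA.diff hB)),
    coeFn_linftyInd (m := m) (hA.inter hB), coeFn_linftyInd (m := m) (hA.diff hB),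
    coeFn_linftyInd (m := m) hA] with z h h1 h2 h3
  rw [h, Pi.add_apply, h1, h2, h3]
  by_cases hzA : z ∈ A <;> by_cases hzB : z ∈ B <;> simp [hzA, hzB]

theorem linftyInd_le_add {A B C : Set Z} (hA : MeasurableSet A) (hB : MeasurableSet B)
    (hC : MeasurableSet C) (h : A ⊆ B ∪ C) :
    linftyInd m hA ≤ linftyInd m hB + linftyInd m hC := by
  rw [← Lp.coeFn_le]
  filter_upwards [Lp.coeFn_add (linftyInd m hB) (linftyInd m hC),
    coeFn_linftyInd (m := m) hA, coeFn_linftyInd (m := m) hB,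
    coeFn_linftyInd (m := m) hC] with z h' h1 h2 h3
  rw [h', Pi.add_apply, h1, h2, h3]
  by_cases hzA : z ∈ A
  · rcases h hzA with hz | hz <;> by_cases hzB : z ∈ B <;> by_cases hzC : z ∈ C <;> simp_all
  · rw [indicator_of_notMem hzA]
    exact add_nonneg (indicator_nonneg (fun _ _ => zero_le_one) z)
      (indicator_nonneg (fun _ _ => zero_le_one) z)

theorem linftyInd_empty : linftyInd m MeasurableSet.empty = 0 := indicatorConstLp_empty

theorem linftyInd_mono {A B : Set Z} (hA : MeasurableSet A) (hB : MeasurableSet B) (h : A ⊆ B) :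
    linftyInd m hA ≤ linftyInd m hB := by
  simpa [linftyInd_empty] using linftyInd_le_add (m := m) hA hB MeasurableSet.empty (by simpa)

theorem linftyInd_of_measure_eq_zero {A : Set Z} (hA : MeasurableSet A) (h : m A = 0) :
    linftyInd m hA = 0 := by
  refine Lp.ext ?_
  filter_upwards [coeFn_linftyInd (m := m) hA, Lp.coeFn_zero ℝ ∞ m,
    measure_eq_zero_iff_ae_notMem.1 h] with z h1 h2 h3
  rw [h1, h2, indicator_of_notMem h3, Pi.zero_apply]

/-- A continuous functional on `L^∞` that is nonnegative on indicator functions is positive. -/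
theorem nonneg_of_linftyInd_nonneg {s : StrongDual ℝ (Lp ℝ ∞ m)}
    (hs : ∀ (A : Set Z) (hA : MeasurableSet A), 0 ≤ s (linftyInd m hA)) (γ : Lp ℝ ∞ m)
    (hγ : 0 ≤ γ) : 0 ≤ s γ := by
  have hmeas (t : ℝ) : MeasurableSet {z | t ≤ γ z} :=
    measurableSet_le measurable_const (Lp.stronglyMeasurable γ).measurable
  have key (n : ℕ) : -(‖s‖ * (1 / ((n : ℝ) + 1))) ≤ s γ := by
    have hn : (0 : ℝ) < n + 1 := by positivity
    set K := ⌊(n + 1) * ‖γ‖⌋₊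
    -- Layer-cake approximation from below: summing the indicators of the level sets at heights `(j
    -- + 1) / (n + 1)` gives `⌊(n + 1)γ⌋ / (n + 1)`, uniformly within `1 / (n + 1)` of `γ`. The
    -- bound `K` suffices because `γ ≤ ‖γ‖`.
    set w : Lp ℝ ∞ m := ∑ j ∈ Finset.range K,
      (1 / ((n : ℝ) + 1)) • linftyInd m (hmeas ((j + 1) / (n + 1))) with hw
    have hw0 : 0 ≤ s w := by
      rw [hw, map_sum]
      refine Finset.sum_nonneg fun j _ => ?_
      rw [map_smul]
      exact mul_nonneg (by positivity) (hs _ _)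
    have hae : ∀ᵐ z ∂m, ‖(γ - w) z‖ ≤ 1 / ((n : ℝ) + 1) := by
      have hsum : ∀ᵐ z ∂m, w z = ∑ j ∈ Finset.range K,
          ((1 / ((n : ℝ) + 1)) • linftyInd m (hmeas ((j + 1) / (n + 1)))) z := by
        rw [hw]
        exact Lp.coeFn_fun_finsetSum (Finset.range K) fun j : ℕ =>
          (1 / ((n : ℝ) + 1)) • linftyInd m (hmeas ((j + 1) / (n + 1)))
      have hterm : ∀ᵐ z ∂m, ∀ j : ℕ,
          ((1 / ((n : ℝ) + 1)) • linftyInd m (hmeas ((j + 1) / (n + 1)))) z =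
            (1 / ((n : ℝ) + 1)) * {z | ((j + 1) / (n + 1) : ℝ) ≤ γ z}.indicator (fun _ => 1) z := by
        refine ae_all_iff.2 fun j => ?_
        filter_upwards [Lp.coeFn_smul (1 / ((n : ℝ) + 1))
          (linftyInd m (hmeas ((j + 1) / (n + 1)))), coeFn_linftyInd (m := m)
            (hmeas ((j + 1) / (n + 1)))] with z h1 h2
        rw [h1, Pi.smul_apply, h2, smul_eq_mul]
      filter_upwards [hsum, hterm, Lp.coeFn_sub γ w, (Lp.coeFn_nonneg γ).2 hγ, ae_norm_le_norm γ]
        with z h1 h2 h3 h4 h5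
      have h4' : 0 ≤ γ z := h4
      have hx : 0 ≤ (n + 1) * γ z := by positivity
      have hfl : ⌊(n + 1) * γ z⌋₊ ≤ K := by
        refine Nat.floor_le_floor ?_
        rw [abs_of_nonneg h4'] at h5
        gcongr
      have hval : w z = (1 / ((n : ℝ) + 1)) * ⌊(n + 1) * γ z⌋₊ := by
        rw [h1, Finset.sum_congr rfl fun j _ => h2 j, ← Finset.mul_sum]
        congr 1
        have : (Finset.range K).filter (fun j : ℕ => ((j + 1) / (n + 1) : ℝ) ≤ γ z) =
            Finset.range ⌊(n + 1) * γ z⌋₊ := by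
          ext j
          rw [Finset.mem_filter, Finset.mem_range, Finset.mem_range, div_le_iff₀' hn]
          have hj : (j + 1 : ℝ) ≤ (n + 1) * γ z ↔ j < ⌊(n + 1) * γ z⌋₊ := by
            rw [← Nat.add_one_le_iff, Nat.le_floor_iff hx]
            push_cast
            rfl
          rw [hj]
          exact ⟨fun h => h.2, fun h => ⟨h.trans_le hfl, h⟩⟩
        simp only [indicator_apply, mem_ofPred_eq]
        rw [Finset.sum_boole, this, Finset.card_range]
      rw [h3, Pi.sub_apply, hval, Real.norm_eq_abs, abs_le]
      have hf1 := Nat.floor_le hx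
      have hf2 := Nat.lt_floor_add_one ((n + 1) * γ z)
      have : γ z - 1 / ((n : ℝ) + 1) * ⌊(n + 1) * γ z⌋₊ =
          1 / ((n : ℝ) + 1) * ((n + 1) * γ z - ⌊(n + 1) * γ z⌋₊) := by
        field_simp
      rw [this]
      have hp : 0 < 1 / ((n : ℝ) + 1) := by positivity
      constructor <;> nlinarith
    have hnorm : ‖γ - w‖ ≤ 1 / ((n : ℝ) + 1) := by
      simpa using Lp.norm_le_of_ae_bound (by positivity) hae
    have h1 : ‖s (γ - w)‖ ≤ ‖s‖ * (1 / ((n : ℝ) + 1)) := s.le_opNorm_of_le hnorm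
    have h2 := (abs_le.1 h1).1
    rw [map_sub] at h2
    linarith
  have hlim : Tendsto (fun n : ℕ => -(‖s‖ * (1 / ((n : ℝ) + 1)))) atTop (𝓝 (-(‖s‖ * 0))) :=
    (tendsto_one_div_add_atTop_nhds_zero_nat.const_mul _).neg
  simpa using le_of_tendsto' hlim key

/-- The set function of a positive functional, extended by `∞` to nonmeasurable sets. -/
def mass (g : StrongDual ℝ (Lp ℝ ∞ m)) : Set Z → ℝ≥0∞ :=
  extend fun (A : Set Z) (hA : MeasurableSet A) => ENNReal.ofReal (g (linftyInd m hA))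

theorem mass_apply (g : StrongDual ℝ (Lp ℝ ∞ m)) {A : Set Z} (hA : MeasurableSet A) :
    mass g A = ENNReal.ofReal (g (linftyInd m hA)) :=
  extend_eq _ hA

theorem mass_empty (g : StrongDual ℝ (Lp ℝ ∞ m)) : mass g ∅ = 0 := by
  rw [mass_apply g MeasurableSet.empty, linftyInd_empty, map_zero, ENNReal.ofReal_zero]

theorem mass_of_not_measurableSet (g : StrongDual ℝ (Lp ℝ ∞ m)) {A : Set Z}
    (hA : ¬MeasurableSet A) : mass g A = ∞ :=
  iInf_neg hA

/-- The countably additive part of a positive functional, as a measure. -/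
def sigmaPart (g : StrongDual ℝ (Lp ℝ ∞ m)) (hg : ∀ γ, 0 ≤ γ → 0 ≤ g γ) : Measure Z :=
  (OuterMeasure.ofFunction (mass g) (mass_empty g)).toMeasure fun A hA => by
    -- Measurable sets split measurable test sets additively because `g` is linear; for other test
    -- sets the value `∞` makes the inequality trivial.
    refine OuterMeasure.ofFunction_caratheodory fun t => ?_
    by_cases ht : MeasurableSet t
    · rw [mass_apply g ht, mass_apply g (ht.inter hA), mass_apply g (ht.diff hA),
        ← ENNReal.ofReal_add (hg _ (linftyInd_nonneg _)) (hg _ (linftyInd_nonneg _)), ← map_add,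
        linftyInd_inter_add_diff ht hA]
    · rw [mass_of_not_measurableSet g ht]
      exact le_top

theorem sigmaPart_le (g : StrongDual ℝ (Lp ℝ ∞ m)) (hg : ∀ γ, 0 ≤ γ → 0 ≤ g γ) {A : Set Z}
    (hA : MeasurableSet A) : sigmaPart g hg A ≤ ENNReal.ofReal (g (linftyInd m hA)) := by
  rw [sigmaPart, toMeasure_apply _ _ hA, ← mass_apply g hA]
  exact OuterMeasure.ofFunction_le A

/-- The outer measure is an infimum over countable covers, and covers with a nonmeasurable member
cost `∞`. A nearly optimal cover is one on whose pieces `g` is almost exhausted by its countably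
additive part. -/
theorem exists_cover_sigmaPart (g : StrongDual ℝ (Lp ℝ ∞ m)) (hg : ∀ γ, 0 ≤ γ → 0 ≤ g γ)
    {η : ℝ≥0∞} (hη : η ≠ 0) :
    ∃ (t : ℕ → Set Z) (ht : ∀ i, MeasurableSet (t i)), ⋃ i, t i = univ ∧
      ∑' i, ENNReal.ofReal (g (linftyInd m (ht i))) ≤ sigmaPart g hg univ + η := by
  have htop : sigmaPart g hg univ ≠ ∞ :=
    ((sigmaPart_le g hg MeasurableSet.univ).trans_lt ENNReal.ofReal_lt_top).ne
  have hlt := ENNReal.lt_add_right htop hη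
  conv_lhs at hlt =>
    rw [sigmaPart, toMeasure_apply _ _ MeasurableSet.univ,
      OuterMeasure.ofFunction_eq_iInf_mem _ _ fun A hA => mass_of_not_measurableSet g hA]
  simp only [iInf_lt_iff] at hlt
  obtain ⟨t, ht, hcov, hlt⟩ := hlt
  refine ⟨t, ht, univ_subset_iff.1 hcov, ?_⟩
  simp only [mass_apply g (ht _)] at hlt
  exact hlt.le

/-- Choose sets `B j` of summable measure with `s` at most `1 / (j + 1)` off `B j`. The tail unions
decrease to measure zero, and the complement of a tail union lies in the complements of arbitrarily
late `B j`, so `s` vanishes there. -/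
theorem purelySingular_of_small {s : StrongDual ℝ (Lp ℝ ∞ m)} (hs : ∀ γ, 0 ≤ γ → 0 ≤ s γ)
    (h : ∀ ε : ℝ≥0∞, ε ≠ 0 → ∀ η : ℝ, 0 < η →
      ∃ (B : Set Z) (hB : MeasurableSet B), m B ≤ ε ∧ s (linftyInd m hB.compl) ≤ η) :
    PurelySingular s := by
  obtain ⟨δ, hδ0, hδ⟩ := ENNReal.exists_pos_sum_of_countable (ε := 1) one_ne_zero ℕ
  choose B hB hmB hsB using fun j : ℕ => h (δ j) (by exact_mod_cast (hδ0 j).ne')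
    (1 / ((j : ℝ) + 1)) (by positivity)
  have hA (k : ℕ) : MeasurableSet (⋃ j, B (j + k)) := MeasurableSet.iUnion fun j => hB _
  refine ⟨fun k => ⋃ j, B (j + k), hA, ?_, ?_, ?_⟩
  · intro k l hkl
    refine iUnion_subset fun j => ?_
    have : j + l = (j + (l - k)) + k := by omega
    rw [this]
    exact subset_iUnion (fun j => B (j + k)) _
  · refine tendsto_of_tendsto_of_tendsto_of_le_of_le tendsto_const_nhds
      (ENNReal.tendsto_sum_nat_add (fun j => (δ j : ℝ≥0∞)) (hδ.trans ENNReal.one_lt_top).ne)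
      (fun _ => zero_le) fun k => ?_
    exact (measure_iUnion_le _).trans (ENNReal.tsum_le_tsum fun j => hmB _)
  · intro k γ hγ
    have hle (j : ℕ) : s (linftyInd m (hA k).compl) ≤ 1 / ((j : ℝ) + 1) := by
      calc s (linftyInd m (hA k).compl) ≤ s (linftyInd m (hB (j + k)).compl) :=
            monotone_of_nonneg (g := s.toLinearMap) hs
              (linftyInd_mono _ _ (compl_subset_compl.2 (subset_iUnion (fun j => B (j + k)) j)))
        _ ≤ 1 / (((j + k : ℕ) : ℝ) + 1) := hsB _
        _ ≤ 1 / ((j : ℝ) + 1) := by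
            push_cast
            gcongr
            linarith [k.cast_nonneg (α := ℝ)]
    have h0 : s (linftyInd m (hA k).compl) = 0 :=
      le_antisymm (ge_of_tendsto' tendsto_one_div_add_atTop_nhds_zero_nat hle)
        (hs _ (linftyInd_nonneg _))
    refine eq_zero_of_abs_le hs h0 (a := ‖γ‖) ?_
    filter_upwards [hγ, ae_norm_le_norm γ, coeFn_linftyInd (m := m) (hA k).compl] with z h1 h2 h3
    rw [h3]
    by_cases hz : z ∈ (⋃ j, B (j + k))ᶜ
    · rw [indicator_of_mem hz, mul_one]
      exact h2
    · rw [indicator_of_notMem hz, h1 hz, mul_zero, abs_zero]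

/-- The Yosida-Hewitt decomposition of a positive functional on `L^∞`. -/
theorem exists_isDecomposition_of_nonneg {g : StrongDual ℝ (Lp ℝ ∞ m)}
    (hg : ∀ γ, 0 ≤ γ → 0 ≤ g γ) :
    ∃ (r : Lp ℝ 1 m) (s : StrongDual ℝ (Lp ℝ ∞ m)),
      IsDecomposition g r s ∧ (∀ᵐ z ∂m, 0 ≤ r z) ∧ ∀ γ, 0 ≤ γ → 0 ≤ s γ := by
  set ν := sigmaPart g hg
  have hνle {A : Set Z} (hA : MeasurableSet A) : ν A ≤ ENNReal.ofReal (g (linftyInd m hA)) :=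
    sigmaPart_le g hg hA
  have hfin : IsFiniteMeasure ν := ⟨(hνle MeasurableSet.univ).trans_lt ENNReal.ofReal_lt_top⟩
  have hac : ν ≪ m := by
    refine Measure.AbsolutelyContinuous.mk fun A hA h0 => ?_
    have := hνle hA
    rw [linftyInd_of_measure_eq_zero hA h0, map_zero, ENNReal.ofReal_zero] at this
    exact le_antisymm this zero_le
  have hInt : Integrable (fun z => (ν.rnDeriv m z).toReal) m := Measure.integrable_toReal_rnDeriv
  set r : Lp ℝ 1 m := (memLp_one_iff_integrable.2 hInt).toLp _
  have hr : r =ᵐ[m] fun z => (ν.rnDeriv m z).toReal := MemLp.coeFn_toLp _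
  have hrA {A : Set Z} (hA : MeasurableSet A) : regular m r (linftyInd m hA) = ν.real A := by
    rw [regular_linftyInd, ← Measure.setIntegral_toReal_rnDeriv hac]
    exact integral_congr_ae (ae_restrict_of_ae hr)
  set s := g - regular m r with hsdef
  have hsA {A : Set Z} (hA : MeasurableSet A) :
      s (linftyInd m hA) = g (linftyInd m hA) - ν.real A := by
    rw [hsdef, sub_apply, hrA]
  have hs0 (A : Set Z) (hA : MeasurableSet A) : 0 ≤ s (linftyInd m hA) := by
    rw [hsA, sub_nonneg]
    exact ENNReal.toReal_le_of_le_ofReal (hg _ (linftyInd_nonneg _)) (hνle hA)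
  have hs := nonneg_of_linftyInd_nonneg hs0
  refine ⟨r, s, ⟨by simp [hsdef], purelySingular_of_small hs ?_⟩, ?_, hs⟩
  · intro ε hε η hη
    obtain ⟨t, ht, hcov, hsum⟩ := exists_cover_sigmaPart g hg
      (η := ENNReal.ofReal η) (by simpa using hη)
    -- The pieces cover, so their `ν`-masses already sum to at least `ν univ`; cancelling this
    -- finite quantity leaves at most `η` for the total of `s` over the pieces.
    have hsplit (i : ℕ) : ENNReal.ofReal (g (linftyInd m (ht i))) =
        ν (t i) + ENNReal.ofReal (s (linftyInd m (ht i))) := by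
      rw [← ofReal_measureReal, ← ENNReal.ofReal_add measureReal_nonneg (hs0 _ _), hsA]
      ring_nf
    simp only [hsplit] at hsum
    rw [ENNReal.tsum_add] at hsum
    have hcovν : ν univ ≤ ∑' i, ν (t i) := by
      rw [← hcov]
      exact measure_iUnion_le _
    have hfin' : ∑' i, ν (t i) ≠ ∞ := by
      refine ((le_self_add.trans hsum).trans_lt ?_).ne
      exact ENNReal.add_lt_top.2 ⟨measure_lt_top ν _, ENNReal.ofReal_lt_top⟩
    have hη' : ∑' i, ENNReal.ofReal (s (linftyInd m (ht i))) ≤ ENNReal.ofReal η :=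
      (ENNReal.add_le_add_iff_left hfin').1 (hsum.trans (by gcongr))
    have hacc (n : ℕ) : MeasurableSet (accumulate t n) :=
      MeasurableSet.biUnion (to_countable _) fun i _ => ht i
    have hsub (n : ℕ) : s (linftyInd m (hacc n)) ≤
        ∑ i ∈ Finset.range (n + 1), s (linftyInd m (ht i)) := by
      have hmono := monotone_of_nonneg (g := s.toLinearMap) hs
      induction n with
      | zero =>
        rw [Finset.sum_range_one]
        exact hmono (linftyInd_mono _ _ (by simp [accumulate_def]))
      | succ n ih =>
        rw [Finset.sum_range_succ]
        have h1 : s (linftyInd m (hacc (n + 1))) ≤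
            s (linftyInd m (hacc n) + linftyInd m (ht (n + 1))) :=
          hmono (linftyInd_le_add _ _ _ (by rw [accumulate_succ]))
        rw [map_add] at h1
        linarith
    have hlim : Tendsto (fun n => m (accumulate t n)ᶜ) atTop (𝓝 0) := by
      have h1 := tendsto_measure_iUnion_accumulate (μ := m) (f := t)
      rw [hcov, measure_univ] at h1
      simp only [prob_compl_eq_one_sub (hacc _)]
      simpa using ENNReal.Tendsto.sub tendsto_const_nhds h1 (Or.inl ENNReal.one_ne_top)
    obtain ⟨n, hn⟩ := (hlim.eventually_le_const hε.bot_lt).exists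
    -- A finite union of pieces has nearly full measure but carries at most `η` of `s`, so its
    -- complement is the small set sought.
    refine ⟨(accumulate t n)ᶜ, (hacc n).compl, hn, ?_⟩
    have hcc : s (linftyInd m (hacc n).compl.compl) = s (linftyInd m (hacc n)) := by
      congr 2
      exact compl_compl _
    rw [hcc]
    refine (hsub n).trans ?_
    rw [← ENNReal.ofReal_le_ofReal_iff hη.le, ENNReal.ofReal_sum_of_nonneg fun i _ => hs0 _ _]
    exact (ENNReal.sum_le_tsum _).trans hη'
  · filter_upwards [hr] with z hz
    rw [hz]
    exact ENNReal.toReal_nonneg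

end YosidaHewitt

/-! ### Bidual membership, dual attainment and approximation by Hahn-Banach. -/

section Duality

variable {Z : Type*} [MeasurableSpace Z] {m : Measure Z} [IsProbabilityMeasure m]

/-- A functional on `L^∞` that vanishes on the annihilator of `E` belongs to the bidual of `E`. -/
theorem exists_bidualEmb_eq (E : Submodule ℝ (Lp ℝ 1 m)) (g : StrongDual ℝ (Lp ℝ ∞ m))
    (hg : ∀ γ : Lp ℝ ∞ m, (∀ f ∈ E, ∫ z, f z * γ z ∂m = 0) → g γ = 0) :
    ∃ h, bidualEmb m E h = g := by
  set R : Lp ℝ ∞ m →L[ℝ] StrongDual ℝ E :=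
    (ContinuousLinearMap.precomp ℝ E.subtypeL) ∘L linftyToDual m with hR
  -- Hahn-Banach lifts each functional on `E` to `L^∞` without increasing its norm. As `g` kills the
  -- kernel of `R`, it factors through `R` and the choice of lift is irrelevant.
  have hC (e : StrongDual ℝ E) : ∃ γ, R γ = e ∧ ‖γ‖ ≤ ‖e‖ := by
    obtain ⟨ℓ, hℓ, hnorm⟩ := exists_extension_norm_eq E e
    obtain ⟨γ, hγ, hγle⟩ := exists_linftyToDual_eq ℓ
    refine ⟨γ, ?_, hγle.trans hnorm.le⟩
    ext f
    simp [hR, hγ, hℓ]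
  have hker {γ₁ γ₂ : Lp ℝ ∞ m} (h : R γ₁ = R γ₂) : g γ₁ = g γ₂ := by
    rw [← sub_eq_zero, ← map_sub]
    refine hg _ fun f hf => ?_
    have h0 : R (γ₁ - γ₂) ⟨f, hf⟩ = 0 := by rw [map_sub, h, sub_self]; rfl
    rwa [← linftyToDual_apply]
  choose inv hinv hnorm using hC
  refine ⟨LinearMap.mkContinuous
    { toFun := fun e => g (inv e)
      map_add' := fun e₁ e₂ => by
        rw [← map_add]
        exact hker (by simp only [map_add, hinv])
      map_smul' := fun a e => by
        rw [RingHom.id_apply, ← map_smul]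
        exact hker (by simp only [map_smul, hinv]) } ‖g‖ fun e => ?_, ?_⟩
  · exact g.le_opNorm_of_le (hnorm e)
  · ext γ
    exact hker (hinv _)

/-- The cone of nonnegative elements of `L^∞`. -/
def linftyCone (m : Measure Z) : PointedCone ℝ (Lp ℝ ∞ m) where
  carrier := {γ | 0 ≤ γ}
  add_mem' := by
    intro γ₁ γ₂ (h₁ : 0 ≤ γ₁) (h₂ : 0 ≤ γ₂)
    exact add_nonneg h₁ h₂
  zero_mem' := le_refl (0 : Lp ℝ ∞ m)
  smul_mem' := fun a γ (hγ : 0 ≤ γ) => by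
    change 0 ≤ (a : ℝ) • γ
    rw [← Lp.coeFn_nonneg] at hγ ⊢
    filter_upwards [hγ, Lp.coeFn_smul (a : ℝ) γ] with z h1 h2
    rw [h2]
    exact mul_nonneg a.2 h1

theorem mem_linftyCone {m : Measure Z} {γ : Lp ℝ ∞ m} : γ ∈ linftyCone m ↔ 0 ≤ γ := Iff.rfl

/-- Attainment in the dual problem: there is a functional below `c` that annihilates `N` and takes
at `1` the value `P` of the primal problem. -/
theorem exists_dual_functional (N : Submodule ℝ (Lp ℝ ∞ m)) (c : Lp ℝ 1 m) (P : ℝ)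
    (hN : ∀ γ ∈ N, ∫ z, γ z ∂m = 0)
    (hP : ∀ γ : Lp ℝ ∞ m, 0 ≤ γ → γ - linftyOne m ∈ N → P ≤ regular m c γ) :
    ∃ h : StrongDual ℝ (Lp ℝ ∞ m), (∀ γ ∈ N, h γ = 0) ∧ h (linftyOne m) = P ∧
      DualLE h (regular m c) := by
  have hInt (γ : Lp ℝ ∞ m) : Integrable γ m := (Lp.memLp γ).integrable le_top
  have hInt1 : ∫ z, linftyOne m z ∂m = 1 := by
    rw [integral_congr_ae (coeFn_linftyOne (m := m))]
    simp
  have h1N : linftyOne m ∉ N := fun h => by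
    have := hN _ h
    rw [hInt1] at this
    exact one_ne_zero this
  -- The functional to extend is the slack `c - h`, which must be positive: on `N` it equals `c`,
  -- and at `1` it equals `⟨c, 1⟩ - P`.
  let f₀ : Lp ℝ ∞ m →ₗ.[ℝ] ℝ := ⟨N, (regular m c).toLinearMap.domRestrict N⟩
  let f := f₀.supSpanSingleton (linftyOne m) (regular m c (linftyOne m) - P) h1N
  have hdom (x : f.domain) : ∃ γ, ∃ hγ : γ ∈ N, ∃ t : ℝ, (x : Lp ℝ ∞ m) = γ + t • linftyOne m ∧
      f x = regular m c γ + t * (regular m c (linftyOne m) - P) := by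
    obtain ⟨x, hx⟩ := x
    obtain ⟨γ, hγ, y, hy, rfl⟩ := Submodule.mem_sup.1 hx
    obtain ⟨t, rfl⟩ := Submodule.mem_span_singleton.1 hy
    exact ⟨γ, hγ, t, rfl, LinearPMap.supSpanSingleton_apply_mk f₀ _ _ h1N γ hγ t⟩
  obtain ⟨g, hgf, hg⟩ := riesz_extension (linftyCone m) f (fun x hx => by
    obtain ⟨γ, hγ, t, hxt, hfx⟩ := hdom x
    rw [hxt, mem_linftyCone] at hx
    rw [hfx]
    have hI : ∫ z, (γ + t • linftyOne m) z ∂m = t := by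
      rw [integral_congr_ae (Lp.coeFn_add _ _)]
      simp only [Pi.add_apply]
      rw [integral_add (hInt _) (hInt _), hN γ hγ, integral_congr_ae (Lp.coeFn_smul t _)]
      simp only [Pi.smul_apply]
      rw [integral_smul, hInt1]
      simp
    have hae := (Lp.coeFn_nonneg _).2 hx
    have ht : 0 ≤ t := by
      rw [← hI]
      exact integral_nonneg_of_ae hae
    -- For `t = 0` a nonnegative element of integral `0` is zero. For `t > 0`, dividing by `t` gives
    -- a feasible point of the primal problem, whose cost is at least `P`.
    rcases ht.eq_or_lt with rfl | ht
    · rw [zero_smul, add_zero] at hI hae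
      have h0 : γ = 0 := by
        refine Lp.ext (((integral_eq_zero_iff_of_nonneg_ae hae (hInt _)).1 hI).trans ?_)
        exact (Lp.coeFn_zero ℝ ∞ m).symm
      simp [h0]
    · have hmem : t⁻¹ • (γ + t • linftyOne m) - linftyOne m ∈ N := by
        rw [smul_add, smul_smul, inv_mul_cancel₀ ht.ne', one_smul, add_sub_cancel_right]
        exact N.smul_mem _ hγ
      have := hP _ ((linftyCone m).smul_mem (inv_pos.2 ht).le hx) hmem
      change P ≤ regular m c (t⁻¹ • (γ + t • linftyOne m)) at this
      rw [map_smul, map_add, map_smul, smul_eq_mul, smul_eq_mul, le_inv_mul_iff₀ ht] at this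
      linarith) (fun y => by
    -- The order unit `1` lies in the domain, so a multiple of it dominates any `-y`.
    refine ⟨⟨‖-y‖ • linftyOne m, ?_⟩, ?_⟩
    · exact Submodule.mem_sup_right (Submodule.smul_mem _ _ (Submodule.mem_span_singleton_self _))
    · rw [mem_linftyCone]
      have := sub_nonneg.2 (le_norm_smul_linftyOne (-y))
      rwa [sub_neg_eq_add] at this)
  have hg' : ∀ γ, 0 ≤ γ → 0 ≤ g γ := fun γ hγ => hg γ hγ
  let G : StrongDual ℝ (Lp ℝ ∞ m) := g.mkContinuous (g (linftyOne m)) fun γ => by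
    rw [mul_comm]
    exact abs_le_norm_mul_of_nonneg hg' γ
  have hGN (γ : Lp ℝ ∞ m) (hγ : γ ∈ N) (t : ℝ) : g (γ + t • linftyOne m) =
      regular m c γ + t * (regular m c (linftyOne m) - P) := by
    have hmem : γ + t • linftyOne m ∈ f.domain := Submodule.add_mem_sup hγ
      (Submodule.smul_mem _ _ (Submodule.mem_span_singleton_self _))
    refine (hgf ⟨_, hmem⟩).trans ?_
    exact LinearPMap.supSpanSingleton_apply_mk f₀ _ _ h1N γ hγ t
  refine ⟨regular m c - G, fun γ hγ => ?_, ?_, fun γ hγ => ?_⟩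
  · have := hGN γ hγ 0
    simp only [zero_smul, add_zero, zero_mul] at this
    simp [G, this]
  · have := hGN 0 N.zero_mem 1
    simp only [one_smul, zero_add, one_mul, map_zero] at this
    simp [G, this]
  · simpa [G] using hg' γ hγ

/-- A functional `r - σ` on `L^∞` with `σ` positive and carried by `A` that annihilates the
annihilator of `S` is approximated by elements of `S`: up to a small error in `L¹` these are of the
form `r - u` with `u ≥ 0` carried by `A` and of integral `σ 1`. -/
theorem exists_approx (S : Submodule ℝ (Lp ℝ 1 m)) (r : Lp ℝ 1 m) (σ : StrongDual ℝ (Lp ℝ ∞ m))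
    (hσ : ∀ γ, 0 ≤ γ → 0 ≤ σ γ)
    (hS : ∀ γ : Lp ℝ ∞ m, (∀ f ∈ S, ∫ z, f z * γ z ∂m = 0) → regular m r γ = σ γ)
    {A : Set Z} (hA : MeasurableSet A) (hσA : VanishesOn σ Aᶜ) {ε : ℝ} (hε : 0 < ε) :
    ∃ f ∈ S, ∃ u : Lp ℝ 1 m, 0 ≤ u ∧ (∀ᵐ z ∂m, z ∉ A → u z = 0) ∧
      ∫ z, u z ∂m = σ (linftyOne m) ∧ ‖f - (r - u)‖ < ε := by
  set U : Set (Lp ℝ 1 m) := {u | 0 ≤ u ∧ (∀ᵐ z ∂m, z ∉ A → u z = 0) ∧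
    ∫ z, u z ∂m = σ (linftyOne m)}
  set K : Set (Lp ℝ 1 m) := {k | ∃ f ∈ S, ∃ u ∈ U, k = r - u - f}
  suffices h : (0 : Lp ℝ 1 m) ∈ closure K by
    obtain ⟨k, ⟨f, hf, u, ⟨hu1, hu2, hu3⟩, rfl⟩, hk⟩ := Metric.mem_closure_iff.1 h ε hε
    refine ⟨f, hf, u, hu1, hu2, hu3, ?_⟩
    rwa [dist_zero_left, norm_sub_rev] at hk
  have hσ1 : 0 ≤ σ (linftyOne m) := by
    rw [← linftyInd_univ]
    exact hσ _ (linftyInd_nonneg _)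
  have hIL (u : Lp ℝ 1 m) : Integrable u m := L1.integrable_coeFn u
  have hUconv : Convex ℝ U := by
    rintro u ⟨hu1, hu2, hu3⟩ v ⟨hv1, hv2, hv3⟩ a b ha hb hab
    have hco : ⇑(a • u + b • v) =ᵐ[m] fun z => a * u z + b * v z := by
      filter_upwards [Lp.coeFn_add (a • u) (b • v), Lp.coeFn_smul a u, Lp.coeFn_smul b v]
        with z h1 h2 h3
      rw [h1, Pi.add_apply, h2, h3]
      rfl
    refine ⟨?_, ?_, ?_⟩
    · rw [← Lp.coeFn_nonneg] at hu1 hv1 ⊢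
      filter_upwards [hu1, hv1, hco] with z h1 h2 h3
      rw [h3]
      exact add_nonneg (mul_nonneg ha h1) (mul_nonneg hb h2)
    · filter_upwards [hu2, hv2, hco] with z h1 h2 h3 hz
      rw [h3, h1 hz, h2 hz]
      simp
    · rw [integral_congr_ae hco, integral_add ((hIL u).const_mul a) ((hIL v).const_mul b),
        integral_const_mul, integral_const_mul, hu3, hv3, ← add_mul, hab, one_mul]
  have hKconv : Convex ℝ K := by
    rintro _ ⟨f, hf, u, hu, rfl⟩ _ ⟨f', hf', u', hu', rfl⟩ a b ha hb hab
    refine ⟨a • f + b • f', S.add_mem (S.smul_mem a hf) (S.smul_mem b hf'), a • u + b • u',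
      hUconv hu hu' ha hb hab, ?_⟩
    have hr : r = a • r + b • r := by rw [← add_smul, hab, one_smul]
    conv_rhs => rw [hr]
    simp only [smul_sub]
    abel
  by_contra h0
  -- If `0` is not in the closure of the convex set `K`, some `γ ∈ L^∞` separates it strictly, with
  -- gap `s > 0`. The remaining steps contradict `hS` at this `γ`.
  obtain ⟨ℓ, s, hs0, hsK⟩ := geometric_hahn_banach_point_closed hKconv.closure isClosed_closure h0
  rw [map_zero] at hs0
  obtain ⟨γ, rfl, -⟩ := exists_linftyToDual_eq ℓ
  have hsep (f : Lp ℝ 1 m) (hf : f ∈ S) (u : Lp ℝ 1 m) (hu : u ∈ U) :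
      s < linftyToDual m γ r - linftyToDual m γ u - linftyToDual m γ f := by
    simpa using hsK _ (subset_closure ⟨f, hf, u, hu, rfl⟩)
  have hBU {B : Set Z} (hB : MeasurableSet B) (hBA : B ⊆ A) (hmB : m B ≠ 0) :
      ((σ (linftyOne m) / m.real B) • indicatorConstLp 1 hB (measure_ne_top m B) (1 : ℝ)) ∈ U := by
    have hBpos : 0 < m.real B := ENNReal.toReal_pos hmB (measure_ne_top m _)
    have hco : ⇑((σ (linftyOne m) / m.real B) • indicatorConstLp 1 hB (measure_ne_top m B) (1 : ℝ))
        =ᵐ[m] B.indicator fun _ => σ (linftyOne m) / m.real B := by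
      filter_upwards [Lp.coeFn_smul (σ (linftyOne m) / m.real B)
        (indicatorConstLp 1 hB (measure_ne_top m B) (1 : ℝ)),
        indicatorConstLp_coeFn (p := 1) (hs := hB) (hμs := measure_ne_top m B) (c := (1 : ℝ))]
        with z h1 h2
      rw [h1, Pi.smul_apply, h2]
      by_cases hz : z ∈ B <;> simp [hz]
    refine ⟨?_, ?_, ?_⟩
    · rw [← Lp.coeFn_nonneg]
      filter_upwards [hco] with z hz
      rw [hz]
      exact indicator_nonneg (fun _ _ => by positivity) z
    · filter_upwards [hco] with z hz hzA
      rw [hz, indicator_of_notMem fun h => hzA (hBA h)]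
    · rw [integral_congr_ae hco, integral_indicator hB, setIntegral_const, smul_eq_mul]
      field_simp
  have hUne : U.Nonempty := by
    by_cases hmA : m A = 0
    · refine ⟨0, le_rfl, ?_, ?_⟩
      · filter_upwards [Lp.coeFn_zero ℝ 1 m] with z hz _
        rw [hz]; rfl
      · rw [integral_congr_ae (Lp.coeFn_zero ℝ 1 m), hσA (linftyOne m)]
        · simp
        · filter_upwards [measure_eq_zero_iff_ae_notMem.1 hmA] with z hz hz'
          exact absurd hz hz'
    · exact ⟨_, hBU hA subset_rfl hmA⟩
  -- A functional bounded on one side on a subspace vanishes there; the multiple of `f` is chosen to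
  -- hit the bound exactly.
  have hann (f : Lp ℝ 1 m) (hf : f ∈ S) : linftyToDual m γ f = 0 := by
    obtain ⟨u, hu⟩ := hUne
    by_contra hne
    have := hsep (((linftyToDual m γ r - linftyToDual m γ u - s) / linftyToDual m γ f) • f)
      (S.smul_mem _ hf) u hu
    rw [map_smul, smul_eq_mul, div_mul_cancel₀ _ hne] at this
    linarith
  have hrσ : linftyToDual m γ r = σ γ := hS γ fun f hf => by
    rw [← linftyToDual_apply]
    exact hann f hf
  have hsepU (u : Lp ℝ 1 m) (hu : u ∈ U) : linftyToDual m γ u < σ γ - s := by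
    have := hsep 0 S.zero_mem u hu
    rw [map_zero, hrσ] at this
    linarith
  rcases hσ1.eq_or_lt with h1 | h1
  · have habs := abs_le_norm_mul_of_nonneg (g := σ.toLinearMap) hσ γ
    simp only [ContinuousLinearMap.coe_coe, ← h1, mul_zero] at habs
    have hγ0 : σ γ = 0 := abs_nonpos_iff.1 habs
    have := hsepU 0 ⟨le_rfl, by
      filter_upwards [Lp.coeFn_zero ℝ 1 m] with z hz _
      rw [hz]; rfl, by
      rw [integral_congr_ae (Lp.coeFn_zero ℝ 1 m), ← h1]; simp⟩
    rw [map_zero, hγ0] at this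
    linarith
  · set L := (σ γ - s) / σ (linftyOne m) with hL
    have hB : MeasurableSet (A ∩ {z | L < γ z}) :=
      hA.inter (measurableSet_lt measurable_const (Lp.stronglyMeasurable γ).measurable)
    -- Otherwise the normalized indicator of this set, scaled to integral `σ 1`, belongs to `U` and
    -- violates `hsepU`. Hence `γ ≤ L` almost everywhere on `A`.
    have hmB : m (A ∩ {z | L < γ z}) = 0 := by
      by_contra hmB
      have hBpos : 0 < m.real (A ∩ {z | L < γ z}) := ENNReal.toReal_pos hmB (measure_ne_top m _)
      have hlt := hsepU _ (hBU hB inter_subset_left hmB)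
      have hind : linftyToDual m γ (indicatorConstLp 1 hB (measure_ne_top m _) (1 : ℝ)) =
          ∫ z in A ∩ {z | L < γ z}, γ z ∂m := by
        rw [linftyToDual_apply, ← integral_indicator hB]
        refine integral_congr_ae ?_
        filter_upwards [indicatorConstLp_coeFn (p := 1) (hs := hB) (hμs := measure_ne_top m _)
          (c := (1 : ℝ))] with z hz
        rw [hz]
        by_cases h : z ∈ A ∩ {z | L < γ z}
        · rw [indicator_of_mem h, indicator_of_mem h, one_mul]
        · rw [indicator_of_notMem h, indicator_of_notMem h, zero_mul]
      have hge : m.real (A ∩ {z | L < γ z}) * L ≤ ∫ z in A ∩ {z | L < γ z}, γ z ∂m := by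
        have := setIntegral_mono_on (μ := m) (f := fun _ => L) (g := γ)
          (integrable_const L).integrableOn ((Lp.memLp γ).integrable le_top).integrableOn hB fun z hz => le_of_lt hz.2
        simpa using this
      rw [map_smul, hind, smul_eq_mul, div_mul_eq_mul_div, div_lt_iff₀ hBpos] at hlt
      have hLσ : L * σ (linftyOne m) = σ γ - s := div_mul_cancel₀ _ h1.ne'
      rw [← hLσ] at hlt
      nlinarith [mul_le_mul_of_nonneg_left hge h1.le]
    -- The multiple of the indicator of `Aᶜ` repairs the sign of `L - γ` off `A` and is invisible to
    -- `σ`. Thus `σ γ ≤ L σ(1) = σ γ - s`, which contradicts `s > 0`.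
    have hle : 0 ≤ σ (L • linftyOne m - γ + ‖L • linftyOne m - γ‖ • linftyInd m hA.compl) := by
      refine hσ _ ?_
      set w := L • linftyOne m - γ
      rw [← Lp.coeFn_nonneg]
      filter_upwards [Lp.coeFn_add w (‖w‖ • linftyInd m hA.compl),
        Lp.coeFn_smul ‖w‖ (linftyInd m hA.compl), coeFn_linftyInd (m := m) hA.compl,
        ae_norm_le_norm w, Lp.coeFn_sub (L • linftyOne m) γ, Lp.coeFn_smul L (linftyOne m),
        coeFn_linftyOne (m := m), measure_eq_zero_iff_ae_notMem.1 hmB]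
        with z h1 h2 h3 h4 h5 h6 h7 h8
      rw [h1, Pi.add_apply, h2, Pi.smul_apply, h3]
      by_cases hz : z ∈ A
      · have : γ z ≤ L := not_lt.1 fun h => h8 ⟨hz, h⟩
        rw [indicator_of_notMem (by simpa using hz), h5, Pi.sub_apply, h6, Pi.smul_apply, h7]
        simpa using this
      · rw [indicator_of_mem (by simpa using hz)]
        simpa using neg_le_iff_add_nonneg.1 (abs_le.1 h4).1
    have hvan : σ (linftyInd m hA.compl) = 0 := by
      refine hσA _ ?_
      filter_upwards [coeFn_linftyInd (m := m) hA.compl] with z hz hzA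
      rw [hz, indicator_of_notMem hzA]
    rw [map_add, map_sub, map_smul, map_smul, hvan, smul_zero, add_zero, smul_eq_mul,
      div_mul_cancel₀ _ h1.ne'] at hle
    linarith

end Duality

/-! ### Almost sure convergence and escaping mass of the approximating sequence. -/

section Escape

variable {Z : Type*} [MeasurableSpace Z] {m : Measure Z}

theorem escapeLim_le_escapeInf (F : ℕ → Z → ℝ) (δ : ℝ≥0∞) :
    escapeLim m F δ ≤ escapeInf m F δ := by
  refine iSup_le fun A => iSup_le fun hA => iSup_le fun hAδ => iSup_le fun l => iSup_le fun hl => ?_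
  refine le_iSup_of_le A (le_iSup_of_le hA (le_iSup_of_le hAδ ?_))
  exact ((continuous_coe_real_ereal.tendsto l).comp hl).liminf_eq.ge

theorem escapeInf_le_escapeSup (F : ℕ → Z → ℝ) (δ : ℝ≥0∞) :
    escapeInf m F δ ≤ escapeSup m F δ := by
  refine iSup_mono fun A => iSup_mono fun hA => iSup_mono fun hAδ => ?_
  exact liminf_le_limsup

theorem tendsto_coe_ereal_of_bounds {f : ℝ≥0∞ → EReal} {a : ℝ}
    (h : ∀ e : ℝ, 0 < e → ∃ δ₀ : ℝ≥0∞, 0 < δ₀ ∧ ∀ δ, 0 < δ → δ < δ₀ →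
      ((a - e : ℝ) : EReal) ≤ f δ ∧ f δ ≤ ((a + e : ℝ) : EReal)) :
    Tendsto f (𝓝[>] 0) (𝓝 (a : EReal)) := by
  have hev {δ₀ : ℝ≥0∞} (h0 : 0 < δ₀) : ∀ᶠ δ in 𝓝[>] (0 : ℝ≥0∞), 0 < δ ∧ δ < δ₀ :=
    Ioo_mem_nhdsGT h0
  refine tendsto_order.2 ⟨fun b hb => ?_, fun b hb => ?_⟩
  · obtain ⟨x, hbx, hxa⟩ := EReal.lt_iff_exists_real_btwn.1 hb
    obtain ⟨δ₀, h0, hδ⟩ := h (a - x) (sub_pos.2 (EReal.coe_lt_coe_iff.1 hxa))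
    filter_upwards [hev h0] with δ hδ'
    have := (hδ δ hδ'.1 hδ'.2).1
    rw [sub_sub_cancel] at this
    exact hbx.trans_le this
  · obtain ⟨x, hax, hxb⟩ := EReal.lt_iff_exists_real_btwn.1 hb
    obtain ⟨δ₀, h0, hδ⟩ := h (x - a) (sub_pos.2 (EReal.coe_lt_coe_iff.1 hax))
    filter_upwards [hev h0] with δ hδ'
    have := (hδ δ hδ'.1 hδ'.2).2
    rw [add_sub_cancel] at this
    exact this.trans_lt hxb

theorem exists_forall_abs_setIntegral_le {r : Z → ℝ} (hr : Integrable r m) {e : ℝ} (he : 0 < e) :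
    ∃ δ₀ : ℝ≥0∞, 0 < δ₀ ∧ ∀ A, m A < δ₀ → |∫ z in A, r z ∂m| ≤ e := by
  obtain ⟨δ₀, h0, h⟩ := exists_pos_setLIntegral_lt_of_measure_lt (μ := m) (f := fun z => ‖r z‖ₑ)
    hr.2.ne (ENNReal.ofReal_pos.2 he).ne'
  refine ⟨δ₀, h0, fun A hA => ?_⟩
  have h1 := (enorm_integral_le_lintegral_enorm (μ := m.restrict A) r).trans (h A hA).le
  rw [Real.enorm_eq_ofReal_abs] at h1
  exact (ENNReal.ofReal_le_ofReal_iff he.le).1 h1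

variable {F u : ℕ → Z → ℝ} {r : Z → ℝ} {B : ℕ → Set Z} {a : ℝ}

/-- Summable `L¹` errors tend to zero almost everywhere, and by Borel-Cantelli almost every point
lies in only finitely many `B n`, so that `u n` eventually vanishes there. -/
theorem ae_tendsto_of_approx (hF : ∀ n, Integrable (F n) m) (hr : Integrable r m)
    (hu : ∀ n, Integrable (u n) m) (huB : ∀ n, ∀ᵐ z ∂m, z ∉ B n → u n z = 0)
    (hB : ∑' n, m (B n) ≠ ∞) (he : ∀ n, ∫ z, |F n z - (r z - u n z)| ∂m ≤ (1 / 2) ^ n) :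
    ∀ᵐ z ∂m, Tendsto (fun n => F n z) atTop (𝓝 (r z)) := by
  have hInt (n : ℕ) : Integrable (fun z => F n z - (r z - u n z)) m := (hF n).sub (hr.sub (hu n))
  have hle (n : ℕ) : ∫⁻ z, ‖F n z - (r z - u n z)‖ₑ ∂m ≤ ENNReal.ofReal ((1 / 2) ^ n) := by
    rw [← ofReal_integral_norm_eq_lintegral_enorm (hInt n)]
    exact ENNReal.ofReal_le_ofReal (he n)
  have hsum : ∫⁻ z, ∑' n, ‖F n z - (r z - u n z)‖ₑ ∂m ≠ ∞ := by
    rw [lintegral_tsum fun n => (hInt n).aestronglyMeasurable.enorm]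
    refine ((ENNReal.tsum_le_tsum hle).trans_lt ?_).ne
    rw [← ENNReal.ofReal_tsum_of_nonneg (fun n => by positivity)
      (summable_geometric_of_lt_one (by norm_num) (by norm_num))]
    exact ENNReal.ofReal_lt_top
  have hfin := ae_lt_top' (AEMeasurable.tsum fun n =>
    (hInt n).aestronglyMeasurable.enorm) hsum
  filter_upwards [hfin, ae_eventually_notMem hB, ae_all_iff.2 huB] with z h1 h2 h3
  have h4 := ENNReal.tendsto_atTop_zero_of_tsum_ne_top h1.ne
  have h5 : Tendsto (fun n => F n z - (r z - u n z)) atTop (𝓝 0) :=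
    tendsto_zero_iff_enorm_tendsto_zero.2 h4
  have h6 : Tendsto (fun n => (F n z - (r z - u n z)) + r z) atTop (𝓝 (r z)) := by
    simpa using h5.add_const (r z)
  refine h6.congr' ?_
  filter_upwards [h2] with n hn
  rw [h3 n hn]
  ring

/-- Subtracting `u n ≥ 0` only lowers `r`, so the positive part of `F n - r` is dominated by the
error. -/
theorem tendsto_eLpNorm_pos_of_approx (hF : ∀ n, Integrable (F n) m) (hr : Integrable r m)
    (hu : ∀ n, Integrable (u n) m) (hu0 : ∀ n, ∀ᵐ z ∂m, 0 ≤ u n z)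
    (he : ∀ n, ∫ z, |F n z - (r z - u n z)| ∂m ≤ (1 / 2) ^ n) :
    Tendsto (fun n => eLpNorm (fun z => max (F n z - r z) 0) 1 m) atTop (𝓝 0) := by
  have hInt (n : ℕ) : Integrable (fun z => F n z - (r z - u n z)) m := (hF n).sub (hr.sub (hu n))
  have hle (n : ℕ) : eLpNorm (fun z => max (F n z - r z) 0) 1 m ≤ ENNReal.ofReal ((1 / 2) ^ n) := by
    calc eLpNorm (fun z => max (F n z - r z) 0) 1 m
        ≤ eLpNorm (fun z => F n z - (r z - u n z)) 1 m := by
          refine eLpNorm_mono_ae ?_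
          filter_upwards [hu0 n] with z hz
          rw [Real.norm_of_nonneg (le_max_right _ _), Real.norm_eq_abs]
          exact max_le ((by linarith : F n z - r z ≤ F n z - (r z - u n z)).trans (le_abs_self _))
            (abs_nonneg _)
      _ = ENNReal.ofReal (∫ z, |F n z - (r z - u n z)| ∂m) := by
          rw [eLpNorm_one_eq_lintegral_enorm, ← ofReal_integral_norm_eq_lintegral_enorm (hInt n)]
          rfl
      _ ≤ _ := ENNReal.ofReal_le_ofReal (he n)
  refine tendsto_of_tendsto_of_tendsto_of_le_of_le tendsto_const_nhds ?_ (fun _ => zero_le) hle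
  have : Tendsto (fun n : ℕ => ((1 : ℝ) / 2) ^ n) atTop (𝓝 0) :=
    tendsto_pow_atTop_nhds_zero_of_lt_one (by norm_num) (by norm_num)
  simpa using ENNReal.tendsto_ofReal this

theorem tendsto_setIntegral_error_of_approx (hF : ∀ n, Integrable (F n) m) (hr : Integrable r m)
    (hu : ∀ n, Integrable (u n) m)
    (he : ∀ n, ∫ z, |F n z - (r z - u n z)| ∂m ≤ (1 / 2) ^ n) (A : Set Z) :
    Tendsto (fun n => ∫ z in A, (F n z - (r z - u n z)) ∂m) atTop (𝓝 0) := by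
  have hInt (n : ℕ) : Integrable (fun z => F n z - (r z - u n z)) m := (hF n).sub (hr.sub (hu n))
  have : Tendsto (fun n : ℕ => ((1 : ℝ) / 2) ^ n) atTop (𝓝 0) :=
    tendsto_pow_atTop_nhds_zero_of_lt_one (by norm_num) (by norm_num)
  refine squeeze_zero_norm (fun n => ?_) this
  exact (norm_integral_le_integral_norm _).trans
    ((setIntegral_le_integral (hInt n).norm (ae_of_all _ fun _ => norm_nonneg _)).trans (he n))

/-- The integral of `r` over small sets is uniformly small and the error vanishes in the limit, so
only the mass of `u n` in `A` counts. It is at most `a`, and equals `a` eventually if `A` is a tail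
union of the `B n`. -/
theorem tendsto_escape_of_approx (hF : ∀ n, Integrable (F n) m) (hr : Integrable r m)
    (hu : ∀ n, Integrable (u n) m) (hu0 : ∀ n, ∀ᵐ z ∂m, 0 ≤ u n z)
    (huB : ∀ n, ∀ᵐ z ∂m, z ∉ B n → u n z = 0) (hua : ∀ n, ∫ z, u n z ∂m = a)
    (hBm : ∀ n, MeasurableSet (B n)) (hB : ∑' n, m (B n) ≠ ∞)
    (he : ∀ n, ∫ z, |F n z - (r z - u n z)| ∂m ≤ (1 / 2) ^ n) :
    Tendsto (escapeLim m F) (𝓝[>] 0) (𝓝 (a : EReal)) ∧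
    Tendsto (escapeInf m F) (𝓝[>] 0) (𝓝 (a : EReal)) ∧
    Tendsto (escapeSup m F) (𝓝[>] 0) (𝓝 (a : EReal)) := by
  have hsplit (A : Set Z) (n : ℕ) : -∫ z in A, F n z ∂m =
      -∫ z in A, r z ∂m + ∫ z in A, u n z ∂m - ∫ z in A, (F n z - (r z - u n z)) ∂m := by
    have h1 : ∫ z in A, (F n z - (r z - u n z)) ∂m =
        ∫ z in A, F n z ∂m - (∫ z in A, r z ∂m - ∫ z in A, u n z ∂m) := by
      have hru : Integrable (fun z => r z - u n z) m := hr.sub (hu n)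
      rw [integral_sub (hF n).integrableOn hru.integrableOn,
        integral_sub hr.integrableOn (hu n).integrableOn]
    rw [h1]
    ring
  have herr := tendsto_setIntegral_error_of_approx hF hr hu he
  have hbounds (e : ℝ) (hpos : 0 < e) : ∃ δ₀ : ℝ≥0∞, 0 < δ₀ ∧ ∀ δ, 0 < δ → δ < δ₀ →
      ((a - e : ℝ) : EReal) ≤ escapeLim m F δ ∧ escapeSup m F δ ≤ ((a + e : ℝ) : EReal) := by
    obtain ⟨δ₀, h0, hδ₀⟩ := exists_forall_abs_setIntegral_le hr hpos
    refine ⟨δ₀, h0, fun δ hδ hδlt => ⟨?_, ?_⟩⟩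
    -- On a tail union of measure below `δ` the inner limit exists, so the same set bounds all three
    -- suprema from below.
    · obtain ⟨N, hN⟩ := ((ENNReal.tendsto_sum_nat_add (fun j => m (B j)) hB).eventually_lt_const
        hδ).exists
      set A := ⋃ j, B (j + N)
      have hAm : MeasurableSet A := MeasurableSet.iUnion fun j => hBm _
      have hAδ : m A < δ := (measure_iUnion_le _).trans_lt hN
      have hlim : Tendsto (fun n => -∫ z in A, F n z ∂m) atTop (𝓝 (-∫ z in A, r z ∂m + a)) := by
        have h1 : Tendsto (fun n => -∫ z in A, r z ∂m + a -
            ∫ z in A, (F n z - (r z - u n z)) ∂m) atTop (𝓝 (-∫ z in A, r z ∂m + a)) := by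
          simpa using (herr A).const_sub (-∫ z in A, r z ∂m + a)
        refine h1.congr' ?_
        filter_upwards [eventually_ge_atTop N] with n hn
        have hAu : ∫ z in A, u n z ∂m = a := by
          rw [← hua n, ← integral_indicator hAm]
          refine integral_congr_ae ?_
          filter_upwards [huB n] with z hz
          by_cases hzA : z ∈ A
          · rw [indicator_of_mem hzA]
          · rw [indicator_of_notMem hzA, hz fun hzB => hzA (mem_iUnion.2 ⟨n - N, ?_⟩)]
            rwa [Nat.sub_add_cancel hn]
        rw [hsplit, hAu]
      refine le_trans ?_ (le_iSup_of_le A (le_iSup_of_le hAm (le_iSup_of_le hAδ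
        (le_iSup_of_le _ (le_iSup_of_le hlim le_rfl)))))
      have := (abs_le.1 (hδ₀ A (hAδ.trans hδlt))).2
      exact EReal.coe_le_coe_iff.2 (by linarith)
    · refine iSup_le fun A => iSup_le fun hAm => iSup_le fun hAδ => ?_
      have hr' := (abs_le.1 (hδ₀ A (hAδ.trans hδlt))).1
      have h1 : Tendsto (fun n => ((a + e - ∫ z in A, (F n z - (r z - u n z)) ∂m : ℝ) : EReal))
          atTop (𝓝 ((a + e : ℝ) : EReal)) := by
        refine (continuous_coe_real_ereal.tendsto _).comp ?_
        simpa using (herr A).const_sub (a + e)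
      rw [← h1.limsup_eq]
      refine limsup_le_limsup (Eventually.of_forall fun n => ?_)
      have hun : ∫ z in A, u n z ∂m ≤ a := by
        rw [← hua n]
        exact setIntegral_le_integral (hu n) (hu0 n)
      refine EReal.coe_le_coe_iff.2 ?_
      rw [hsplit]
      linarith
  refine ⟨?_, ?_, ?_⟩ <;> refine tendsto_coe_ereal_of_bounds fun e hpos => ?_ <;>
    obtain ⟨δ₀, h0, hδ₀⟩ := hbounds e hpos <;>
    refine ⟨δ₀, h0, fun δ hδ hδlt => ?_⟩ <;>
    obtain ⟨hl, hs⟩ := hδ₀ δ hδ hδlt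
  · exact ⟨hl, ((escapeLim_le_escapeInf F δ).trans (escapeInf_le_escapeSup F δ)).trans hs⟩
  · exact ⟨hl.trans (escapeLim_le_escapeInf F δ), (escapeInf_le_escapeSup F δ).trans hs⟩
  · exact ⟨hl.trans ((escapeLim_le_escapeInf F δ).trans (escapeInf_le_escapeSup F δ)), hs⟩

/-- A functional `r - σ` on `L^∞` with `σ` positive and purely singular that annihilates the
annihilator of `S` is approximated by a sequence in `S`. -/
theorem exists_approx_seq [IsProbabilityMeasure m] (S : Submodule ℝ (Lp ℝ 1 m)) (r : Lp ℝ 1 m)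
    (σ : StrongDual ℝ (Lp ℝ ∞ m)) (hσ : ∀ γ, 0 ≤ γ → 0 ≤ σ γ)
    (hS : ∀ γ : Lp ℝ ∞ m, (∀ f ∈ S, ∫ z, f z * γ z ∂m = 0) → regular m r γ = σ γ)
    (hps : PurelySingular σ) :
    ∃ (f u : ℕ → Lp ℝ 1 m) (B : ℕ → Set Z), (∀ n, f n ∈ S) ∧ (∀ n, ∀ᵐ z ∂m, 0 ≤ u n z) ∧
      (∀ n, ∀ᵐ z ∂m, z ∉ B n → u n z = 0) ∧ (∀ n, ∫ z, u n z ∂m = σ (linftyOne m)) ∧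
      (∀ n, MeasurableSet (B n)) ∧ ∑' n, m (B n) ≠ ∞ ∧
      ∀ n, ∫ z, |f n z - (r z - u n z)| ∂m ≤ (1 / 2) ^ n := by
  obtain ⟨A, hAm, -, hA0, hAσ⟩ := hps
  have hstep (n : ℕ) : ∃ (f u : Lp ℝ 1 m) (B : Set Z), f ∈ S ∧ (∀ᵐ z ∂m, 0 ≤ u z) ∧
      (∀ᵐ z ∂m, z ∉ B → u z = 0) ∧ ∫ z, u z ∂m = σ (linftyOne m) ∧ MeasurableSet B ∧
      m B ≤ (1 / 2) ^ n ∧ ∫ z, |f z - (r z - u z)| ∂m ≤ (1 / 2) ^ n := by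
    have hpos : (0 : ℝ≥0∞) < (1 / 2) ^ n := by
      refine pos_iff_ne_zero.2 (pow_ne_zero _ ?_)
      simp
    obtain ⟨k, hk⟩ := (hA0.eventually_le_const hpos).exists
    obtain ⟨f, hf, u, hu0, huA, hu1, hfu⟩ := exists_approx S r σ hσ hS (hAm k) (hAσ k)
      (ε := (1 / 2) ^ n) (by positivity)
    refine ⟨f, u, A k, hf, (Lp.coeFn_nonneg u).2 hu0, huA, hu1, hAm k, hk, ?_⟩
    rw [L1.norm_eq_integral_norm] at hfu
    refine (integral_congr_ae ?_).trans_le hfu.le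
    filter_upwards [Lp.coeFn_sub f (r - u), Lp.coeFn_sub r u] with z h1 h2
    rw [h1, Pi.sub_apply, h2, Pi.sub_apply, Real.norm_eq_abs]
  choose f u B hf hu0 huB hu1 hBm hB he using hstep
  refine ⟨f, u, B, hf, hu0, huB, hu1, hBm, ?_, he⟩
  refine ((ENNReal.tsum_le_tsum hB).trans_lt ?_).ne
  rw [ENNReal.tsum_geometric]
  simp

end Escape

/-! ### Bounded plans as the feasible points of a linear programme, and weak duality. -/

section Transport

variable {X Y : Type*} [MeasurableSpace X] [MeasurableSpace Y] {μ : Measure X} {ν : Measure Y}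
  {π₀ π : Measure (X × Y)} {c : X × Y → ℝ≥0∞} {φ : X → ℝ} {ψ : Y → ℝ}

theorem integrable_oplus (h1 : π.fst = μ) (h2 : π.snd = ν) (hφ : Integrable φ μ)
    (hψ : Integrable ψ ν) : Integrable (oplus φ ψ) π := by
  subst h1 h2
  exact (hφ.comp_measurable measurable_fst).add (hψ.comp_measurable measurable_snd)

theorem integral_oplus (h1 : π.fst = μ) (h2 : π.snd = ν) (hφ : Integrable φ μ)
    (hψ : Integrable ψ ν) : ∫ z, oplus φ ψ z ∂π = ∫ x, φ x ∂μ + ∫ y, ψ y ∂ν := by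
  subst h1 h2
  have h1 : ∫ z : X × Y, φ z.1 ∂π = ∫ x, φ x ∂π.fst :=
    (integral_map measurable_fst.aemeasurable hφ.aestronglyMeasurable).symm
  have h2 : ∫ z : X × Y, ψ z.2 ∂π = ∫ y, ψ y ∂π.snd :=
    (integral_map measurable_snd.aemeasurable hψ.aestronglyMeasurable).symm
  rw [← h1, ← h2]
  exact integral_add (hφ.comp_measurable measurable_fst) (hψ.comp_measurable measurable_snd)

/-- The linear subspace of `L¹(π₀)` whose closure is `L¹_S(π₀)`. -/
def oplusSpan (μ : Measure X) (ν : Measure Y) (π₀ : Measure (X × Y)) : Submodule ℝ (Lp ℝ 1 π₀) :=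
  Submodule.span ℝ {f : Lp ℝ 1 π₀ | ∃ (φ : X → ℝ) (ψ : Y → ℝ),
    Integrable φ μ ∧ Integrable ψ ν ∧ f =ᵐ[π₀] oplus φ ψ}

theorem oplusSpan_le_L1S : oplusSpan μ ν π₀ ≤ L1S μ ν π₀ := Submodule.le_topologicalClosure _

theorem exists_oplus_of_mem_oplusSpan {f : Lp ℝ 1 π₀} (hf : f ∈ oplusSpan μ ν π₀) :
    ∃ (φ : X → ℝ) (ψ : Y → ℝ), Integrable φ μ ∧ Integrable ψ ν ∧ f =ᵐ[π₀] oplus φ ψ := by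
  induction hf using Submodule.span_induction with
  | mem f hf => exact hf
  | zero =>
    refine ⟨0, 0, integrable_zero _ _ _, integrable_zero _ _ _, ?_⟩
    filter_upwards [Lp.coeFn_zero ℝ 1 π₀] with z hz
    rw [hz]
    simp [oplus]
  | add f g _ _ hf hg =>
    obtain ⟨φ, ψ, hφ, hψ, hf⟩ := hf
    obtain ⟨φ', ψ', hφ', hψ', hg⟩ := hg
    refine ⟨φ + φ', ψ + ψ', hφ.add hφ', hψ.add hψ', ?_⟩
    filter_upwards [Lp.coeFn_add f g, hf, hg] with z h1 h2 h3
    rw [h1, Pi.add_apply, h2, h3]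
    simp only [oplus, Pi.add_apply]
    ring
  | smul a f _ hf =>
    obtain ⟨φ, ψ, hφ, hψ, hf⟩ := hf
    refine ⟨a • φ, a • ψ, hφ.smul a, hψ.smul a, ?_⟩
    filter_upwards [Lp.coeFn_smul a f, hf] with z h1 h2
    rw [h1, Pi.smul_apply, h2]
    simp only [oplus, Pi.smul_apply, smul_eq_mul]
    ring

/-- The annihilator in `L^∞(π₀)` of the functions `φ ⊕ ψ`. -/
def oplusAnnihilator (h1 : π₀.fst = μ) (h2 : π₀.snd = ν) : Submodule ℝ (Lp ℝ ∞ π₀) where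
  carrier := {γ | ∀ (φ : X → ℝ) (ψ : Y → ℝ), Integrable φ μ → Integrable ψ ν →
    ∫ z, oplus φ ψ z * γ z ∂π₀ = 0}
  zero_mem' := fun φ ψ _ _ => by
    rw [integral_eq_zero_of_ae]
    filter_upwards [Lp.coeFn_zero ℝ ∞ π₀] with z hz
    rw [hz]
    simp
  add_mem' := by
    intro γ₁ γ₂ hγ₁ hγ₂ φ ψ hφ hψ
    have hI := integrable_oplus h1 h2 hφ hψ
    calc ∫ z, oplus φ ψ z * (γ₁ + γ₂) z ∂π₀
        = ∫ z, (oplus φ ψ z * γ₁ z + oplus φ ψ z * γ₂ z) ∂π₀ := by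
          refine integral_congr_ae ?_
          filter_upwards [Lp.coeFn_add γ₁ γ₂] with z hz
          rw [hz, Pi.add_apply, mul_add]
      _ = 0 := by
          rw [integral_add (integrable_mul_linfty hI γ₁) (integrable_mul_linfty hI γ₂),
            hγ₁ φ ψ hφ hψ, hγ₂ φ ψ hφ hψ, add_zero]
  smul_mem' := by
    intro a γ hγ φ ψ hφ hψ
    calc ∫ z, oplus φ ψ z * (a • γ) z ∂π₀ = ∫ z, a * (oplus φ ψ z * γ z) ∂π₀ := by
          refine integral_congr_ae ?_
          filter_upwards [Lp.coeFn_smul a γ] with z hz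
          rw [hz, Pi.smul_apply, smul_eq_mul]
          ring
      _ = 0 := by rw [integral_const_mul, hγ φ ψ hφ hψ, mul_zero]

theorem mem_oplusAnnihilator {h1 : π₀.fst = μ} {h2 : π₀.snd = ν} {γ : Lp ℝ ∞ π₀} :
    γ ∈ oplusAnnihilator h1 h2 ↔ ∀ (φ : X → ℝ) (ψ : Y → ℝ), Integrable φ μ → Integrable ψ ν →
      ∫ z, oplus φ ψ z * γ z ∂π₀ = 0 :=
  Iff.rfl

theorem mem_oplusAnnihilator_of_forall {h1 : π₀.fst = μ} {h2 : π₀.snd = ν} {γ : Lp ℝ ∞ π₀}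
    (h : ∀ f ∈ oplusSpan μ ν π₀, ∫ z, f z * γ z ∂π₀ = 0) : γ ∈ oplusAnnihilator h1 h2 := by
  refine mem_oplusAnnihilator.2 fun φ ψ hφ hψ => ?_
  have hmem := memLp_one_iff_integrable.2 (integrable_oplus h1 h2 hφ hψ)
  rw [← h (hmem.toLp _) (Submodule.subset_span ⟨φ, ψ, hφ, hψ, hmem.coeFn_toLp⟩)]
  refine integral_congr_ae ?_
  filter_upwards [hmem.coeFn_toLp] with z hz
  rw [hz]

theorem coeFn_density (hπ : π ∈ boundedPlans μ ν π₀) :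
    density hπ =ᵐ[π₀] fun z => (π.rnDeriv π₀ z).toReal :=
  MemLp.coeFn_toLp _

theorem density_nonneg (hπ : π ∈ boundedPlans μ ν π₀) : 0 ≤ density hπ := by
  rw [← Lp.coeFn_nonneg]
  filter_upwards [coeFn_density hπ] with z hz
  rw [hz]
  exact ENNReal.toReal_nonneg

theorem integral_mul_density [IsProbabilityMeasure π₀] (hπ : π ∈ boundedPlans μ ν π₀)
    (f : X × Y → ℝ) : ∫ z, f z * density hπ z ∂π₀ = ∫ z, f z ∂π := by
  have := hπ.1.1
  rw [← integral_toReal_rnDeriv_mul hπ.2.1]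
  refine integral_congr_ae ?_
  filter_upwards [coeFn_density hπ] with z hz
  rw [hz, mul_comm]

theorem integral_mul_linftyOne [IsProbabilityMeasure π₀] (f : X × Y → ℝ) :
    ∫ z, f z * linftyOne π₀ z ∂π₀ = ∫ z, f z ∂π₀ := by
  refine integral_congr_ae ?_
  filter_upwards [coeFn_linftyOne (m := π₀)] with z hz
  rw [hz, mul_one]

theorem integral_mul_sub_linftyOne [IsProbabilityMeasure π₀] {f : X × Y → ℝ}
    (hf : Integrable f π₀) (γ : Lp ℝ ∞ π₀) :
    ∫ z, f z * (γ - linftyOne π₀) z ∂π₀ = ∫ z, f z * γ z ∂π₀ - ∫ z, f z ∂π₀ := by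
  rw [← integral_mul_linftyOne f, ← integral_sub (integrable_mul_linfty hf _)
    (integrable_mul_linfty hf _)]
  refine integral_congr_ae ?_
  filter_upwards [Lp.coeFn_sub γ (linftyOne π₀)] with z hz
  rw [hz, Pi.sub_apply, mul_sub]

/-- A plan and `π₀` share their marginals, so they give `φ ⊕ ψ` the same integral. -/
theorem density_sub_mem [IsProbabilityMeasure π₀] (h1 : π₀.fst = μ) (h2 : π₀.snd = ν)
    (hπ : π ∈ boundedPlans μ ν π₀) : density hπ - linftyOne π₀ ∈ oplusAnnihilator h1 h2 := by
  refine mem_oplusAnnihilator.2 fun φ ψ hφ hψ => ?_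
  rw [integral_mul_sub_linftyOne (integrable_oplus h1 h2 hφ hψ), integral_mul_density,
    integral_oplus hπ.1.2.1 hπ.1.2.2 hφ hψ, integral_oplus h1 h2 hφ hψ, sub_self]

theorem coeFn_costClass (hc : Measurable c) (hπ₀ : π₀ ∈ finitePlans μ ν c) :
    costClass hc hπ₀ =ᵐ[π₀] fun z => (c z).toReal :=
  MemLp.coeFn_toLp _

theorem ae_cost_lt_top (hc : Measurable c) (hπ₀ : π₀ ∈ finitePlans μ ν c) :
    ∀ᵐ z ∂π₀, c z < ∞ :=
  ae_lt_top hc hπ₀.2.ne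

theorem regular_costClass (hc : Measurable c) (hπ₀ : π₀ ∈ finitePlans μ ν c) (γ : Lp ℝ ∞ π₀) :
    regular π₀ (costClass hc hπ₀) γ = ∫ z, (c z).toReal * γ z ∂π₀ := by
  rw [regular_apply]
  refine integral_congr_ae ?_
  filter_upwards [coeFn_costClass hc hπ₀] with z hz
  rw [hz]

theorem ofReal_regular_costClass (hc : Measurable c) (hπ₀ : π₀ ∈ finitePlans μ ν c)
    {γ : Lp ℝ ∞ π₀} (hγ : 0 ≤ γ) :
    ENNReal.ofReal (regular π₀ (costClass hc hπ₀) γ) =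
      ∫⁻ z, ENNReal.ofReal (γ z) * c z ∂π₀ := by
  have hγ' := (Lp.coeFn_nonneg γ).2 hγ
  rw [regular_costClass, ofReal_integral_eq_lintegral_ofReal (integrable_mul_linfty
    (memLp_one_iff_integrable.1 (memLp_cost hc hπ₀)) γ)]
  · refine lintegral_congr_ae ?_
    filter_upwards [ae_cost_lt_top hc hπ₀] with z hz
    rw [ENNReal.ofReal_mul ENNReal.toReal_nonneg, ENNReal.ofReal_toReal hz.ne, mul_comm]
  · filter_upwards [hγ'] with z hz
    exact mul_nonneg ENNReal.toReal_nonneg hz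

theorem ofReal_regular_costClass_density (hc : Measurable c) (hπ₀ : π₀ ∈ finitePlans μ ν c)
    (hπ : π ∈ boundedPlans μ ν π₀) :
    ENNReal.ofReal (regular π₀ (costClass hc hπ₀) (density hπ)) = ∫⁻ z, c z ∂π := by
  have := hπ₀.1.1
  have := hπ.1.1
  rw [ofReal_regular_costClass hc hπ₀ (density_nonneg hπ),
    ← lintegral_rnDeriv_mul hπ.2.1 hc.aemeasurable]
  refine lintegral_congr_ae ?_
  filter_upwards [coeFn_density hπ, Measure.rnDeriv_lt_top π π₀] with z h1 h2
  rw [h1, ENNReal.ofReal_toReal h2.ne]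

theorem regular_costClass_nonneg (hc : Measurable c) (hπ₀ : π₀ ∈ finitePlans μ ν c)
    {γ : Lp ℝ ∞ π₀} (hγ : 0 ≤ γ) : 0 ≤ regular π₀ (costClass hc hπ₀) γ := by
  rw [regular_costClass]
  refine integral_nonneg_of_ae ?_
  filter_upwards [(Lp.coeFn_nonneg γ).2 hγ] with z hz
  exact mul_nonneg ENNReal.toReal_nonneg hz

/-- A nonnegative `γ` with the same integrals of the functions `φ ⊕ ψ` as `1` is the density of a
plan. -/
theorem withDensity_mem_boundedPlans [IsProbabilityMeasure μ] [IsFiniteMeasure ν]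
    [IsProbabilityMeasure π₀] (h1 : π₀.fst = μ) (h2 : π₀.snd = ν) {γ : Lp ℝ ∞ π₀} (hγ : 0 ≤ γ)
    (hN : γ - linftyOne π₀ ∈ oplusAnnihilator h1 h2) :
    π₀.withDensity (fun z => ENNReal.ofReal (γ z)) ∈ boundedPlans μ ν π₀ := by
  have hγ' := (Lp.coeFn_nonneg γ).2 hγ
  have hInt : Integrable γ π₀ := (Lp.memLp γ).integrable le_top
  have hmeas : Measurable fun z => ENNReal.ofReal (γ z) :=
    (Lp.stronglyMeasurable γ).measurable.ennreal_ofReal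
  have heq {φ : X → ℝ} {ψ : Y → ℝ} (hφ : Integrable φ μ) (hψ : Integrable ψ ν) :
      ∫ z, oplus φ ψ z * γ z ∂π₀ = ∫ x, φ x ∂μ + ∫ y, ψ y ∂ν := by
    have := mem_oplusAnnihilator.1 hN φ ψ hφ hψ
    rw [integral_mul_sub_linftyOne (integrable_oplus h1 h2 hφ hψ), integral_oplus h1 h2 hφ hψ]
      at this
    linarith
  have happ {A : Set (X × Y)} (hA : MeasurableSet A) :
      π₀.withDensity (fun z => ENNReal.ofReal (γ z)) A = ENNReal.ofReal (∫ z in A, γ z ∂π₀) := by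
    rw [withDensity_apply _ hA, ofReal_integral_eq_lintegral_ofReal hInt.integrableOn
      (ae_restrict_of_ae hγ')]
  have hfst : (π₀.withDensity fun z => ENNReal.ofReal (γ z)).fst = μ := by
    ext A hA
    rw [Measure.fst_apply hA, happ (measurable_fst hA), ← ofReal_measureReal (μ := μ)]
    -- Testing with `φ = 1_A` and `ψ = 0` reads off the first marginal.
    have := heq ((integrable_const (1 : ℝ)).indicator hA) (integrable_zero Y ℝ ν)
    rw [integral_indicator hA, setIntegral_const, smul_eq_mul, mul_one, integral_zero',
      add_zero] at this
    rw [← this, ← integral_indicator (measurable_fst hA)]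
    congr 1
    refine integral_congr_ae (ae_of_all _ fun z => ?_)
    by_cases hz : z.1 ∈ A <;> simp [oplus, hz, indicator]
  have hsnd : (π₀.withDensity fun z => ENNReal.ofReal (γ z)).snd = ν := by
    ext A hA
    rw [Measure.snd_apply hA, happ (measurable_snd hA), ← ofReal_measureReal (μ := ν)]
    have := heq (integrable_zero X ℝ μ) ((integrable_const (1 : ℝ)).indicator hA)
    rw [integral_indicator hA, setIntegral_const, smul_eq_mul, mul_one, integral_zero',
      zero_add] at this
    rw [← this, ← integral_indicator (measurable_snd hA)]
    congr 1
    refine integral_congr_ae (ae_of_all _ fun z => ?_)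
    by_cases hz : z.2 ∈ A <;> simp [oplus, hz, indicator]
  refine ⟨⟨⟨?_⟩, hfst, hsnd⟩, withDensity_absolutelyContinuous _ _, ?_⟩
  · rw [← Measure.fst_univ, hfst, measure_univ]
  · refine lt_of_le_of_lt (essSup_le_of_ae_le (ENNReal.ofReal ‖γ‖) ?_) ENNReal.ofReal_lt_top
    filter_upwards [Measure.rnDeriv_withDensity π₀ hmeas, ae_norm_le_norm γ] with z hz1 hz2
    rw [hz1]
    exact ENNReal.ofReal_le_ofReal ((le_abs_self _).trans hz2)

theorem primalValue_ne_top (hπ₀ : π₀ ∈ finitePlans μ ν c) : primalValue μ ν c π₀ ≠ ∞ :=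
  ((iInf₂_le π₀ (mem_boundedPlans_self hπ₀)).trans_lt hπ₀.2).ne

theorem primalValue_toReal_le [IsProbabilityMeasure μ] [IsFiniteMeasure ν]
    [IsProbabilityMeasure π₀] (hc : Measurable c) (hπ₀ : π₀ ∈ finitePlans μ ν c)
    {γ : Lp ℝ ∞ π₀} (hγ : 0 ≤ γ)
    (hN : γ - linftyOne π₀ ∈ oplusAnnihilator hπ₀.1.2.1 hπ₀.1.2.2) :
    (primalValue μ ν c π₀).toReal ≤ regular π₀ (costClass hc hπ₀) γ := by
  have hmeas : Measurable fun z => ENNReal.ofReal (γ z) :=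
    (Lp.stronglyMeasurable γ).measurable.ennreal_ofReal
  refine ENNReal.toReal_le_of_le_ofReal (regular_costClass_nonneg hc hπ₀ hγ) ?_
  rw [ofReal_regular_costClass hc hπ₀ hγ]
  refine (iInf₂_le _ (withDensity_mem_boundedPlans hπ₀.1.2.1 hπ₀.1.2.2 hγ hN)).trans ?_
  rw [lintegral_withDensity_eq_lintegral_mul _ hmeas hc]
  rfl

/-- Weak duality, with the error due to the relaxation of the constraint. -/
theorem relaxedDualValue_le [IsProbabilityMeasure π₀] (hc : Measurable c)
    (hπ₀ : π₀ ∈ finitePlans μ ν c) (hπ : π ∈ boundedPlans μ ν π₀) {ε : ℝ} (hε : 0 ≤ ε) :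
    relaxedDualValue μ ν c π₀ ε ≤
      ((regular π₀ (costClass hc hπ₀) (density hπ) + ‖density hπ‖ * ε : ℝ) : EReal) := by
  refine sSup_le ?_
  rintro _ ⟨φ, ψ, hφ, hψ, hle, rfl⟩
  refine EReal.coe_le_coe_iff.2 ?_
  have hI := integrable_oplus hπ₀.1.2.1 hπ₀.1.2.2 hφ hψ
  have hcI : Integrable (fun z => (c z).toReal) π₀ :=
    memLp_one_iff_integrable.1 (memLp_cost hc hπ₀)
  have hmeas : AEMeasurable (fun z => ENNReal.ofReal (oplus φ ψ z) - c z) π₀ :=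
    hI.aestronglyMeasurable.aemeasurable.ennreal_ofReal.sub hc.aemeasurable
  have hfin := (hle.trans_lt ENNReal.ofReal_lt_top).ne
  have hwI := integrable_toReal_of_lintegral_ne_top hmeas hfin
  have hw : ∫ z, (ENNReal.ofReal (oplus φ ψ z) - c z).toReal ∂π₀ ≤ ε := by
    rw [integral_toReal hmeas (ae_lt_top' hmeas hfin)]
    exact ENNReal.toReal_le_of_le_ofReal hε hle
  rw [← integral_oplus hπ.1.2.1 hπ.1.2.2 hφ hψ, ← integral_mul_density hπ, regular_costClass]
  calc ∫ z, oplus φ ψ z * density hπ z ∂π₀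
      ≤ ∫ z, ((c z).toReal * density hπ z +
          ‖density hπ‖ * (ENNReal.ofReal (oplus φ ψ z) - c z).toReal) ∂π₀ := by
        refine integral_mono_ae (integrable_mul_linfty hI _)
          ((integrable_mul_linfty hcI _).add (hwI.const_mul _)) ?_
        filter_upwards [ae_cost_lt_top hc hπ₀, ae_norm_le_norm (density hπ),
          (Lp.coeFn_nonneg _).2 (density_nonneg hπ)] with z h1 h2 h3
        -- Pointwise `φ ⊕ ψ ≤ c + (φ ⊕ ψ - c)₊`; multiplying by the density, which is at most its
        -- norm, turns the violation `ε` into the error `‖dπ/dπ₀‖ ε`.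
        have h4 : oplus φ ψ z - (c z).toReal ≤ (ENNReal.ofReal (oplus φ ψ z) - c z).toReal := by
          refine le_trans ?_ (ENNReal.le_toReal_sub h1.ne)
          rw [ENNReal.toReal_ofReal']
          gcongr
          exact le_max_left _ _
        have h5 : (0 : ℝ) ≤ (ENNReal.ofReal (oplus φ ψ z) - c z).toReal := ENNReal.toReal_nonneg
        have h3' : 0 ≤ density hπ z := h3
        have h2' : density hπ z ≤ ‖density hπ‖ := (le_abs_self _).trans h2
        nlinarith [mul_le_mul_of_nonneg_right h4 h3', mul_le_mul_of_nonneg_left h2' h5]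
    _ = ∫ z, (c z).toReal * density hπ z ∂π₀ +
          ‖density hπ‖ * ∫ z, (ENNReal.ofReal (oplus φ ψ z) - c z).toReal ∂π₀ := by
        rw [integral_add (integrable_mul_linfty hcI _) (hwI.const_mul _), integral_const_mul]
    _ ≤ _ := by gcongr

/-- Approximate dual feasibility of a sequence of pairs gives a lower bound for the relaxed dual
values. -/
theorem le_relaxedDualValue {φ : ℕ → X → ℝ} {ψ : ℕ → Y → ℝ} (hφ : ∀ n, Integrable (φ n) μ)
    (hψ : ∀ n, Integrable (ψ n) ν) {r : X × Y → ℝ} (hr : ∀ᵐ z ∂π₀, ENNReal.ofReal (r z) ≤ c z)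
    (hpos : Tendsto (fun n => eLpNorm (fun z => max (oplus (φ n) (ψ n) z - r z) 0) 1 π₀)
      atTop (𝓝 0)) {P : ℝ}
    (hP : Tendsto (fun n => ∫ x, φ n x ∂μ + ∫ y, ψ n y ∂ν) atTop (𝓝 P)) {ε : ℝ} (hε : 0 < ε) :
    (P : EReal) ≤ relaxedDualValue μ ν c π₀ ε := by
  refine le_of_tendsto ((continuous_coe_real_ereal.tendsto P).comp hP) ?_
  -- As `r ≤ c`, the excess over `c` is at most the excess over `r`, which is eventually below `ε`.
  filter_upwards [hpos.eventually_le_const (ENNReal.ofReal_pos.2 hε)] with n hn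
  refine le_sSup ⟨φ n, ψ n, hφ n, hψ n, le_trans ?_ hn, rfl⟩
  rw [eLpNorm_one_eq_lintegral_enorm]
  refine lintegral_mono_ae ?_
  filter_upwards [hr] with z hz
  rw [tsub_le_iff_right, Real.enorm_of_nonneg (le_max_right _ _)]
  calc ENNReal.ofReal (oplus (φ n) (ψ n) z)
      ≤ ENNReal.ofReal (max (oplus (φ n) (ψ n) z - r z) 0 + r z) :=
        ENNReal.ofReal_le_ofReal (by linarith [le_max_left (oplus (φ n) (ψ n) z - r z) 0])
    _ ≤ ENNReal.ofReal (max (oplus (φ n) (ψ n) z - r z) 0) + ENNReal.ofReal (r z) :=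
        ENNReal.ofReal_add_le
    _ ≤ _ := by gcongr

/-- For the upper bound, fix a nearly optimal plan before letting `ε ↓ 0`: the norm of its density
may be large but does not depend on `ε`. -/
theorem tendsto_relaxedDualValue [IsProbabilityMeasure π₀] (hc : Measurable c)
    (hπ₀ : π₀ ∈ finitePlans μ ν c)
    (h : ∀ ε : ℝ, 0 < ε → (primalValue μ ν c π₀ : EReal) ≤ relaxedDualValue μ ν c π₀ ε) :
    Tendsto (relaxedDualValue μ ν c π₀) (𝓝[>] 0) (𝓝 (primalValue μ ν c π₀ : EReal)) := by
  refine tendsto_order.2 ⟨fun b hb => ?_, fun b hb => ?_⟩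
  · filter_upwards [self_mem_nhdsWithin] with ε hε
    exact hb.trans_le (h ε hε)
  · obtain ⟨x, hPx, hxb⟩ := EReal.lt_iff_exists_real_btwn.1 hb
    have hx0 : 0 ≤ x := by
      have : (0 : EReal) ≤ x := (EReal.coe_ennreal_nonneg _).trans hPx.le
      exact_mod_cast this
    have hPx' : primalValue μ ν c π₀ < ENNReal.ofReal x := by
      rw [← EReal.coe_ennreal_lt_coe_ennreal_iff, EReal.coe_ennreal_ofReal, max_eq_left hx0]
      exact hPx
    simp only [primalValue, iInf_lt_iff] at hPx'
    obtain ⟨π, hπ, hlt⟩ := hPx'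
    rw [← ofReal_regular_costClass_density hc hπ₀ hπ, ENNReal.ofReal_lt_ofReal_iff_of_nonneg
      (regular_costClass_nonneg hc hπ₀ (density_nonneg hπ))] at hlt
    have hlim : Tendsto (fun ε : ℝ => regular π₀ (costClass hc hπ₀) (density hπ) +
        ‖density hπ‖ * ε) (𝓝[>] 0) (𝓝 (regular π₀ (costClass hc hπ₀) (density hπ))) := by
      have : Continuous fun ε : ℝ => regular π₀ (costClass hc hπ₀) (density hπ) +
        ‖density hπ‖ * ε := by fun_prop
      simpa using (this.tendsto 0).mono_left nhdsWithin_le_nhds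
    filter_upwards [hlim.eventually_lt_const hlt, self_mem_nhdsWithin] with ε h1 h2
    exact (relaxedDualValue_le hc hπ₀ hπ (le_of_lt h2)).trans_lt
      ((EReal.coe_lt_coe_iff.2 h1).trans hxb)

end Transport

end MongeKantorovich

end

/-! ### The dual optimizer, absence of a gap, slackness and the optimizing sequence. -/

theorem theorem3p1 {X Y : Type*}
    [TopologicalSpace X] [PolishSpace X] [MeasurableSpace X] [BorelSpace X]
    [TopologicalSpace Y] [PolishSpace Y] [MeasurableSpace Y] [BorelSpace Y]
    (μ : Measure X) [IsProbabilityMeasure μ] (ν : Measure Y) [IsProbabilityMeasure ν]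
    (c : X × Y → ℝ≥0∞) (hc : Measurable c)
    (π₀ : Measure (X × Y)) (hπ₀ : π₀ ∈ finitePlans μ ν c) :
    -- the limit defining the dual value exists, and there is no duality gap
    Tendsto (relaxedDualValue μ ν c π₀) (𝓝[>] 0) (𝓝 (dualValue μ ν c π₀)) ∧
    (primalValue μ ν c π₀ : EReal) = dualValue μ ν c π₀ ∧
    -- `h` is the dual optimizer, `hr` its regular part and `hs` its purely singular part
    ∃ (h : StrongDual ℝ (StrongDual ℝ (L1S μ ν π₀))) (hr : Lp ℝ 1 π₀)
      (hs : StrongDual ℝ (Lp ℝ ∞ π₀)),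
      IsDecomposition (bidualEmb π₀ (L1S μ ν π₀) h) hr hs ∧
      DualLE (bidualEmb π₀ (L1S μ ν π₀) h) (regular π₀ (costClass hc hπ₀)) ∧
      (∀ᵐ z ∂π₀, ((hr z : ℝ) : EReal) ≤ (c z : EReal)) ∧
      DualLE hs 0 ∧
      dualValue μ ν c π₀ =
        ((bidualEmb π₀ (L1S μ ν π₀) h (density (mem_boundedPlans_self hπ₀)) : ℝ) : EReal) ∧
      (∀ (π : Measure (X × Y)) (hπ : π ∈ boundedPlans μ ν π₀) (α : ℝ), 0 ≤ α →
        ∫⁻ z, c z ∂π ≤ primalValue μ ν c π₀ + ENNReal.ofReal α →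
        -α ≤ hs (density hπ) ∧ hs (density hπ) ≤ 0) ∧
      (∀ π ∈ boundedPlans μ ν π₀, ∫⁻ z, c z ∂π = primalValue μ ν c π₀ →
        ∀ ε : ℝ≥0∞, 0 < ε → VanishesOn hs {z | ε < π.rnDeriv π₀ z}) ∧
      ∃ (φ : ℕ → X → ℝ) (ψ : ℕ → Y → ℝ),
        (∀ n, Integrable (φ n) μ) ∧ (∀ n, Integrable (ψ n) ν) ∧
        (∀ᵐ z ∂π₀, Tendsto (fun n => oplus (φ n) (ψ n) z) atTop (𝓝 (hr z))) ∧
        Tendsto (fun n => eLpNorm (fun z => max (oplus (φ n) (ψ n) z - hr z) 0) 1 π₀)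
          atTop (𝓝 0) ∧
        Tendsto (escapeLim π₀ (fun n => oplus (φ n) (ψ n))) (𝓝[>] 0) (𝓝 ((‖hs‖ : ℝ) : EReal)) ∧
        Tendsto (escapeInf π₀ (fun n => oplus (φ n) (ψ n))) (𝓝[>] 0) (𝓝 ((‖hs‖ : ℝ) : EReal)) ∧
        Tendsto (escapeSup π₀ (fun n => oplus (φ n) (ψ n))) (𝓝[>] 0) (𝓝 ((‖hs‖ : ℝ) : EReal)) := by
  have hprob : IsProbabilityMeasure π₀ := hπ₀.1.1
  set N := oplusAnnihilator hπ₀.1.2.1 hπ₀.1.2.2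
  set C := costClass hc hπ₀
  set P := (primalValue μ ν c π₀).toReal
  have hPcoe : ((P : ℝ) : EReal) = (primalValue μ ν c π₀ : EReal) :=
    EReal.coe_ennreal_toReal (primalValue_ne_top hπ₀)
  obtain ⟨H, hHN, hH1, hHle⟩ := exists_dual_functional N C P
    (fun γ hγ => by
      have := mem_oplusAnnihilator.1 hγ (fun _ => 1) (fun _ => 0) (integrable_const _)
        (integrable_const _)
      simpa [oplus] using this)
    (fun γ hγ hN => primalValue_toReal_le hc hπ₀ hγ hN)
  -- Decomposing the positive slack `C - H` instead of `H` gives both parts a sign.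
  obtain ⟨r, s, ⟨hdec, hps⟩, hr0, hs0⟩ := exists_isDecomposition_of_nonneg
    (g := regular π₀ C - H) fun γ hγ => by
      rw [sub_apply, sub_nonneg]
      exact hHle γ hγ
  have hHdec (γ : Lp ℝ ∞ π₀) : H γ = regular π₀ (C - r) γ - s γ := by
    have := DFunLike.congr_fun hdec γ
    rw [sub_apply, add_apply] at this
    rw [map_sub, sub_apply]
    linarith
  obtain ⟨h, hh⟩ := exists_bidualEmb_eq (L1S μ ν π₀) H fun γ hγ =>
    hHN γ (mem_oplusAnnihilator_of_forall fun f hf => hγ f (oplusSpan_le_L1S hf))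
  have hHdens {π : Measure (X × Y)} (hπ : π ∈ boundedPlans μ ν π₀) : H (density hπ) = P := by
    have := hHN _ (density_sub_mem hπ₀.1.2.1 hπ₀.1.2.2 hπ)
    rw [map_sub, hH1] at this
    linarith
  have hrle : ∀ᵐ z ∂π₀, (C - r) z ≤ (c z).toReal := by
    filter_upwards [Lp.coeFn_sub C r, coeFn_costClass hc hπ₀, hr0] with z h1 h2 h3
    rw [h1, Pi.sub_apply, h2]
    linarith
  -- The approximation runs in the span and not in its closure, so that each `f n` is a genuine `φ ⊕
  -- ψ`; both have the same annihilator.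
  obtain ⟨f, u, B, hf, hu0, huB, hu1, hBm, hB, he⟩ := exists_approx_seq (oplusSpan μ ν π₀) (C - r) s
    hs0 (fun γ hγ => by
      have h0 := hHN γ (mem_oplusAnnihilator_of_forall hγ)
      rw [hHdec] at h0
      linarith) hps
  choose φ ψ hφ hψ hfφ using fun n => exists_oplus_of_mem_oplusSpan (hf n)
  have hFint (n : ℕ) : Integrable (oplus (φ n) (ψ n)) π₀ :=
    integrable_oplus hπ₀.1.2.1 hπ₀.1.2.2 (hφ n) (hψ n)
  have hrint : Integrable (C - r : Lp ℝ 1 π₀) π₀ := L1.integrable_coeFn _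
  have huint (n : ℕ) : Integrable (u n) π₀ := L1.integrable_coeFn _
  have he' (n : ℕ) : ∫ z, |oplus (φ n) (ψ n) z - ((C - r) z - u n z)| ∂π₀ ≤ (1 / 2) ^ n := by
    refine le_trans (integral_congr_ae ?_).le (he n)
    filter_upwards [hfφ n] with z hz
    rw [hz]
  have hpos := tendsto_eLpNorm_pos_of_approx hFint hrint huint hu0 he'
  have hsnorm : ‖-s‖ = s (linftyOne π₀) := by rw [norm_neg, norm_eq_of_nonneg hs0]
  have hesc := tendsto_escape_of_approx hFint hrint huint hu0 huB hu1 hBm hB he'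
  -- The error integrates over the whole space to the dual value of the pair minus `∫ (C - r) - s(1)
  -- = H(1) = P`.
  have hlim : Tendsto (fun n => ∫ x, φ n x ∂μ + ∫ y, ψ n y ∂ν) atTop (𝓝 P) := by
    have h1 := tendsto_setIntegral_error_of_approx hFint hrint huint he' univ
    simp only [Measure.restrict_univ] at h1
    have h2 := h1.add_const P
    rw [zero_add] at h2
    refine h2.congr fun n => ?_
    have hru : Integrable (fun z => (C - r) z - u n z) π₀ := hrint.sub (huint n)
    rw [integral_sub (hFint n) hru, integral_sub hrint (huint n), hu1,
      integral_oplus hπ₀.1.2.1 hπ₀.1.2.2 (hφ n) (hψ n), ← hH1, hHdec, regular_apply,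
      integral_mul_linftyOne]
    ring
  have hofReal : ∀ᵐ z ∂π₀, ENNReal.ofReal ((C - r) z) ≤ c z := by
    filter_upwards [hrle] with z hz using ENNReal.ofReal_le_of_le_toReal hz
  have htend := tendsto_relaxedDualValue hc hπ₀ fun ε hε =>
    hPcoe ▸ le_relaxedDualValue hφ hψ hofReal hpos hlim hε
  have hdual : dualValue μ ν c π₀ = primalValue μ ν c π₀ := htend.limUnder_eq
  have hsdens {π : Measure (X × Y)} (hπ : π ∈ boundedPlans μ ν π₀) {α : ℝ} (hα : 0 ≤ α)
      (hle : ∫⁻ z, c z ∂π ≤ primalValue μ ν c π₀ + ENNReal.ofReal α) : s (density hπ) ≤ α := by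
    rw [← ofReal_regular_costClass_density hc hπ₀ hπ,
      ← ENNReal.ofReal_toReal (primalValue_ne_top hπ₀),
      ← ENNReal.ofReal_add ENNReal.toReal_nonneg hα,
      ENNReal.ofReal_le_ofReal_iff (add_nonneg ENNReal.toReal_nonneg hα)] at hle
    have h1 := hHdec (density hπ)
    rw [hHdens, map_sub, sub_apply] at h1
    -- Since `H` takes the value `P` at every plan, the cost exceeds `P` by `⟨r, π⟩ + s(π)`;
    -- dropping the first term bounds the second by `α`.
    have h2 : 0 ≤ regular π₀ r (density hπ) := by
      rw [regular_apply]
      refine integral_nonneg_of_ae ?_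
      filter_upwards [hr0, (Lp.coeFn_nonneg _).2 (density_nonneg hπ)] with z h3 h4
      exact mul_nonneg h3 h4
    linarith
  rw [hdual]
  refine ⟨htend, rfl, h, C - r, -s, ⟨?_, ?_⟩, ?_, ?_, ?_, ?_, ?_, ?_, φ, ψ, hφ, hψ, ?_, hpos, ?_⟩
  · ext γ
    rw [hh, hHdec, add_apply, neg_apply]
    ring
  · obtain ⟨A, hA1, hA2, hA3, hA4⟩ := hps
    refine ⟨A, hA1, hA2, hA3, fun k γ hγ => ?_⟩
    rw [neg_apply, hA4 k γ hγ, neg_zero]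
  · rw [hh]
    exact hHle
  · filter_upwards [hrle, ae_cost_lt_top hc hπ₀] with z h1 h2
    rw [← EReal.coe_ennreal_toReal h2.ne]
    exact EReal.coe_le_coe_iff.2 h1
  · intro γ hγ
    simpa using hs0 γ hγ
  · rw [hh, hHdens, hPcoe]
  · intro π hπ α hα hle
    rw [neg_apply]
    exact ⟨neg_le_neg (hsdens hπ hα hle), neg_nonpos.2 (hs0 _ (density_nonneg hπ))⟩
  · intro π hπ hopt ε hε γ hγ
    have hπp : IsProbabilityMeasure π := hπ.1.1
    have h0 : s (density hπ) = 0 :=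
      le_antisymm (hsdens hπ le_rfl (by simpa using hopt.le)) (hs0 _ (density_nonneg hπ))
    -- The truncation covers `ε = ∞`, where `toReal` would give `0`.
    have hε1 : min ε 1 ≠ ∞ := (min_le_right ε 1).trans_lt ENNReal.one_lt_top |>.ne
    have hε0 : 0 < (min ε 1).toReal := ENNReal.toReal_pos (lt_min hε one_pos).ne' hε1
    -- Where the density exceeds `ε`, `|γ|` is at most `‖γ‖ / min ε 1` times the density, at which
    -- the positive `s` vanishes.
    rw [neg_apply, eq_zero_of_abs_le hs0 h0 (a := ‖γ‖ / (min ε 1).toReal), neg_zero]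
    filter_upwards [hγ, ae_norm_le_norm γ, coeFn_density hπ, Measure.rnDeriv_lt_top π π₀]
      with z h1 h2 h3 h4
    rw [h3]
    by_cases hz : z ∈ {z | ε < π.rnDeriv π₀ z}
    · have hz' : ε < π.rnDeriv π₀ z := hz
      have h5 : (min ε 1).toReal ≤ (π.rnDeriv π₀ z).toReal :=
        ENNReal.toReal_mono h4.ne ((min_le_left _ _).trans hz'.le)
      refine h2.trans ?_
      rw [div_mul_eq_mul_div, le_div_iff₀ hε0]
      gcongr
    · rw [h1 hz, abs_zero]
      positivity
  · exact ae_tendsto_of_approx hFint hrint huint huB hB he'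
  · rw [hsnorm]
    exact hesc
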